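/- Let $\mathbb K\in\{\mathbb R,\mathbb C\}$. Let $H=\bigoplus_{n\ge 0}H_n$ be a graded and connected Hopf algebra over $\mathbb K$, i.e. a Hopf algebra with a decomposition into subspaces such that $H_nH_m\subseteq H_{n+m}$ and $\Delta(H_n)\subseteq\bigoplus_{k+l=n}H_k\otimes H_l$ for all $n,m\ge 0$, and $H_0\cong\mathbb K$. Let $B$ be a locally convex algebra over $\mathbb K$, i.e. an associative unital $\mathbb K$-algebra which is a Hausdorff locally convex topological vector space with continuous multiplication $\mu_B\colon B\times B\to B$. Endow spaces $\operatorname{Hom}_{\mathbb K}(X,B)$ of linear maps with the topology of pointwise convergence, let $\phi\star\psi=\mu_B\circ(\phi\otimes\psi)\circ\Delta$ be the convolution on $\operatorname{Hom}_{\mathbb K}(H,B)$, with unit $\psi^{\star 0}=(x\mapsto\epsilon(x)1_B)$, and regard $\mathcal I:=\operatorname{Hom}_{\mathbb K}(\bigoplus_{n\ge 1}H_n,B)$ as the subspace of those maps in $\operatorname{Hom}_{\mathbb K}(H,B)$ which vanish on $H_0$. A map $f$ between Hausdorff locally convex spaces (defined on an open set) is $C^\infty_{\mathbb K}$ if all its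 iterated directional derivatives $(x,y_1,\dots,y_k)\mapsto (D_{y_k}\cdots D_{y_1}f)(x)$ over $\mathbb K$ exist and are continuous. For $\mathbb K=\mathbb C$, $f$ is called $\mathbb K$-analytic if it is $C^\infty_{\mathbb C}$; for $\mathbb K=\mathbb R$, $f$ is called $\mathbb K$-analytic if it extends to a $C^\infty_{\mathbb C}$-map from an open neighbourhood of its domain in the complexification of the source space to the complexification of the target space. Then: 1. For every $\psi\in\mathcal I$ and every $n\ge 0$ only finitely many of the maps $\psi^{\star k}$, $k\ge 0$, are non-zero on $H_n$; in particular the series $\exp(\psi):=\sum_{k=0}^\infty\frac{\psi^{\star k}}{k!}$ converges in $\operatorname{Hom}_{\mathbb K}(H,B)$. 2. The map $\exp\colon\mathcal I\to\operatorname{Hom}_{\mathbb K}(H,B)$ is $\mathbb K$-analytic. 3. If $B$ is commutative, then every infinitesimal character, i.e. every linear map $\phi\colon H\to B$ with $\phi(ab)=\phi(a)\epsilon(b)+\epsilon(a)\phi(b)$ for all $a,b\in H$, lies in $\mathcal I$, and $\exp$ restricts to a bijection from the set $\operatorname{InfChar}(H,B)$ of infinitesimal characters onto the set $\operatorname{Char}(H,B)$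 of characters, i.e. of unital algebra homomorphisms $H\to B$. -/

import Mathlib

open Filter Topology TensorProduct

noncomputable section

/-! ### Calculus on topological vector spaces -/

section Calculus

variable {E F : Type*} [AddCommGroup E] [TopologicalSpace E] [AddCommGroup F] [TopologicalSpace F]

/-- `v` is the directional derivative of `f` at `x` in the direction `h`:
`v = lim_{𝕜ˣ ∋ t → 0} t⁻¹ (f (x + t h) - f x)`. -/
def HasDirectionalDeriv (𝕜 : Type*) [RCLike 𝕜] [Module 𝕜 E] [Module 𝕜 F]
    (f : E → F) (x h : E) (v : F) : Prop :=
  Tendsto (fun t : 𝕜 => t⁻¹ • (f (x + t • h) - f x)) (𝓝[≠] 0) (𝓝 v)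

/-- `f` is of class `C^∞` over `𝕜` on the open set `U` in the sense of Bastiani: all iterated
directional derivatives `d k x (y₁, …, y_k) = (D_{y_k} ⋯ D_{y₁} f) x` exist for `x ∈ U`, and define
continuous maps `U × E^k → F`. Only the values of `f` on `U` matter. -/
def IsBastianiSmoothOn (𝕜 : Type*) [RCLike 𝕜] [Module 𝕜 E] [Module 𝕜 F]
    (U : Set E) (f : E → F) : Prop :=
  ∃ d : (k : ℕ) → E → (Fin k → E) → F,
    (∀ x ∈ U, d 0 x ![] = f x) ∧
    (∀ k, ∀ x ∈ U, ∀ (y : Fin k → E) (h : E),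
      HasDirectionalDeriv 𝕜 (fun x' => d k x' y) x h (d (k + 1) x (Fin.snoc y h))) ∧
    ∀ k, ContinuousOn (fun q : E × (Fin k → E) => d k q.1 q.2) (U ×ˢ Set.univ)

/-- The complexification `E × E` of a real vector space `E`, with the product topology. The pair
`(u, v)` stands for `u + i v`. The field `𝕜` is a copy of `ℝ` wherever this is used; it appears as
a parameter so that the real scalars act through the given `𝕜`-module structure. -/
def Complexification (_𝕜 : Type*) (E : Type*) : Type _ := E × E

namespace Complexification

variable (𝕜 : Type*) [RCLike 𝕜] [Module 𝕜 E]

instance : AddCommGroup (Complexification 𝕜 E) := inferInstanceAs (AddCommGroup (E × E))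

instance : TopologicalSpace (Complexification 𝕜 E) := inferInstanceAs (TopologicalSpace (E × E))

/-- `(x + i y) • (u, v) = (x u - y v, x v + y u)`. -/
instance : SMul ℂ (Complexification 𝕜 E) where
  smul z w := (((z.re : 𝕜) • w.1 - (z.im : 𝕜) • w.2 : E), ((z.re : 𝕜) • w.2 + (z.im : 𝕜) • w.1 : E))

instance : Module ℂ (Complexification 𝕜 E) where
  one_smul w := by
    refine Prod.ext ?_ ?_
    · change (((1 : ℂ).re : ℝ) : 𝕜) • w.1 - (((1 : ℂ).im : ℝ) : 𝕜) • w.2 = w.1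
      simp
    · change (((1 : ℂ).re : ℝ) : 𝕜) • w.2 + (((1 : ℂ).im : ℝ) : 𝕜) • w.1 = w.2
      simp
  mul_smul a b w := by
    refine Prod.ext ?_ ?_
    · change (((a * b).re : ℝ) : 𝕜) • w.1 - (((a * b).im : ℝ) : 𝕜) • w.2 =
        ((a.re : ℝ) : 𝕜) • (((b.re : ℝ) : 𝕜) • w.1 - ((b.im : ℝ) : 𝕜) • w.2) -
        ((a.im : ℝ) : 𝕜) • (((b.re : ℝ) : 𝕜) • w.2 + ((b.im : ℝ) : 𝕜) • w.1)
      simp only [Complex.mul_re, Complex.mul_im, RCLike.ofReal_sub, RCLike.ofReal_add,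
        RCLike.ofReal_mul]
      module
    · change (((a * b).re : ℝ) : 𝕜) • w.2 + (((a * b).im : ℝ) : 𝕜) • w.1 =
        ((a.re : ℝ) : 𝕜) • (((b.re : ℝ) : 𝕜) • w.2 + ((b.im : ℝ) : 𝕜) • w.1) +
        ((a.im : ℝ) : 𝕜) • (((b.re : ℝ) : 𝕜) • w.1 - ((b.im : ℝ) : 𝕜) • w.2)
      simp only [Complex.mul_re, Complex.mul_im, RCLike.ofReal_sub, RCLike.ofReal_add,
        RCLike.ofReal_mul]
      module
  smul_zero a := by
    refine Prod.ext ?_ ?_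
    · change ((a.re : ℝ) : 𝕜) • (0 : E) - ((a.im : ℝ) : 𝕜) • (0 : E) = 0
      simp
    · change ((a.re : ℝ) : 𝕜) • (0 : E) + ((a.im : ℝ) : 𝕜) • (0 : E) = 0
      simp
  smul_add a w w' := by
    refine Prod.ext ?_ ?_
    · change ((a.re : ℝ) : 𝕜) • (w.1 + w'.1) - ((a.im : ℝ) : 𝕜) • (w.2 + w'.2) =
        (((a.re : ℝ) : 𝕜) • w.1 - ((a.im : ℝ) : 𝕜) • w.2) +
        (((a.re : ℝ) : 𝕜) • w'.1 - ((a.im : ℝ) : 𝕜) • w'.2)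
      module
    · change ((a.re : ℝ) : 𝕜) • (w.2 + w'.2) + ((a.im : ℝ) : 𝕜) • (w.1 + w'.1) =
        (((a.re : ℝ) : 𝕜) • w.2 + ((a.im : ℝ) : 𝕜) • w.1) +
        (((a.re : ℝ) : 𝕜) • w'.2 + ((a.im : ℝ) : 𝕜) • w'.1)
      module
  add_smul a b w := by
    refine Prod.ext ?_ ?_
    · change (((a + b).re : ℝ) : 𝕜) • w.1 - (((a + b).im : ℝ) : 𝕜) • w.2 =
        (((a.re : ℝ) : 𝕜) • w.1 - ((a.im : ℝ) : 𝕜) • w.2) +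
        (((b.re : ℝ) : 𝕜) • w.1 - ((b.im : ℝ) : 𝕜) • w.2)
      simp only [Complex.add_re, Complex.add_im, RCLike.ofReal_add]
      module
    · change (((a + b).re : ℝ) : 𝕜) • w.2 + (((a + b).im : ℝ) : 𝕜) • w.1 =
        (((a.re : ℝ) : 𝕜) • w.2 + ((a.im : ℝ) : 𝕜) • w.1) +
        (((b.re : ℝ) : 𝕜) • w.2 + ((b.im : ℝ) : 𝕜) • w.1)
      simp only [Complex.add_re, Complex.add_im, RCLike.ofReal_add]
      module
  zero_smul w := by
    refine Prod.ext ?_ ?_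
    · change (((0 : ℂ).re : ℝ) : 𝕜) • w.1 - (((0 : ℂ).im : ℝ) : 𝕜) • w.2 = 0
      simp
    · change (((0 : ℂ).re : ℝ) : 𝕜) • w.2 + (((0 : ℂ).im : ℝ) : 𝕜) • w.1 = 0
      simp

/-- The inclusion `E → E_ℂ`, `u ↦ (u, 0)`. -/
def incl (u : E) : Complexification 𝕜 E := ((u, 0) : E × E)

end Complexification

/-- Real analyticity on the open set `U` (for `𝕜` a copy of `ℝ`): `f` extends to a `C^∞_ℂ`-map on an
open neighbourhood of `U` in the complexification, with values in the complexification. -/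
def IsRealAnalyticOn (𝕜 : Type*) [RCLike 𝕜] [Module 𝕜 E] [Module 𝕜 F]
    (U : Set E) (f : E → F) : Prop :=
  ∃ (V : Set (Complexification 𝕜 E)) (g : Complexification 𝕜 E → Complexification 𝕜 F),
    IsOpen V ∧ (∀ x ∈ U, Complexification.incl 𝕜 x ∈ V) ∧
    (∀ x ∈ U, g (Complexification.incl 𝕜 x) = Complexification.incl 𝕜 (f x)) ∧
    IsBastianiSmoothOn ℂ V g

/-- `𝕜`-analyticity on the open set `U`, for `𝕜 ∈ {ℝ, ℂ}`. For an `RCLike` field, `𝕜` is (a copy of)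
`ℝ` exactly when `RCLike.I = 0`. Complex analytic means `C^∞_ℂ`. -/
def IsAnalyticMapOn (𝕜 : Type*) [RCLike 𝕜] [Module 𝕜 E] [Module 𝕜 F]
    (U : Set E) (f : E → F) : Prop :=
  ((RCLike.I : 𝕜) = 0 → IsRealAnalyticOn 𝕜 U f) ∧
  ((RCLike.I : 𝕜) ≠ 0 → IsBastianiSmoothOn 𝕜 U f)

end Calculus

/-- The topology of pointwise convergence on the space of all linear maps. -/
instance pointwiseTopology {𝕜 M B : Type*} [Semiring 𝕜] [AddCommMonoid M] [AddCommMonoid B]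
    [Module 𝕜 M] [Module 𝕜 B] [TopologicalSpace B] : TopologicalSpace (M →ₗ[𝕜] B) :=
  TopologicalSpace.induced (fun (φ : M →ₗ[𝕜] B) (x : M) => φ x) Pi.topologicalSpace

/-! ### Graded and connected Hopf algebras -/

section Hopf

variable {𝕜 H B : Type*} [RCLike 𝕜] [Ring H] [HopfAlgebra 𝕜 H] [Ring B] [Algebra 𝕜 B]

/-- The subspaces `𝒜 n` turn `H` into a graded and connected Hopf algebra. -/
structure IsGradedConnected (𝒜 : ℕ → Submodule 𝕜 H) : Prop where
  isInternal : DirectSum.IsInternal 𝒜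
  mul_mem : ∀ n m : ℕ, ∀ a ∈ 𝒜 n, ∀ b ∈ 𝒜 m, a * b ∈ 𝒜 (n + m)
  comul_mem : ∀ n : ℕ, ∀ a ∈ 𝒜 n, Coalgebra.comul (R := 𝕜) a ∈
    ⨆ (p : ℕ × ℕ) (_ : p.1 + p.2 = n),
      LinearMap.range (TensorProduct.map (𝒜 p.1).subtype (𝒜 p.2).subtype)
  connected : Nonempty (𝒜 0 ≃ₗ[𝕜] 𝕜)

/-- The subspace `⨁_{n ≥ 1} H_n` of `H`. -/
def positivePart (𝒜 : ℕ → Submodule 𝕜 H) : Submodule 𝕜 H := ⨆ n ∈ Set.Ici 1, 𝒜 n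

theorem IsGradedConnected.isCompl {𝒜 : ℕ → Submodule 𝕜 H} (h𝒜 : IsGradedConnected 𝒜) :
    IsCompl (positivePart 𝒜) (𝒜 0) := by
  constructor
  · exact (h𝒜.isInternal.submodule_iSupIndep.disjoint_biSup (x := 0) (y := Set.Ici 1)
      (by simp)).symm
  · rw [codisjoint_iff, eq_top_iff, ← h𝒜.isInternal.submodule_iSup_eq_top]
    refine iSup_le fun n => ?_
    rcases Nat.eq_zero_or_pos n with rfl | hn
    · exact le_sup_right
    · exact le_sup_of_le_left (le_biSup 𝒜 (Set.mem_Ici.2 hn))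

/-- The identification of a linear map on `⨁_{n ≥ 1} H_n` with the linear map on
`H = H_0 ⊕ ⨁_{n ≥ 1} H_n` which vanishes on `H_0`. -/
def extendByZero {𝒜 : ℕ → Submodule 𝕜 H} (h𝒜 : IsGradedConnected 𝒜)
    (ψ : positivePart 𝒜 →ₗ[𝕜] B) : H →ₗ[𝕜] B :=
  ψ ∘ₗ (positivePart 𝒜).projectionOnto (𝒜 0) h𝒜.isCompl

/-- The `k`-th power of `φ` for the convolution product
`φ ⋆ ψ = μ_B ∘ (φ ⊗ ψ) ∘ Δ_H`; the zeroth power is `u_B ∘ ε_H`. -/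
def convPow (φ : H →ₗ[𝕜] B) (k : ℕ) : H →ₗ[𝕜] B := (WithConv.toConv φ ^ k).ofConv

/-- The exponential series `∑_k ψ^{⋆k} / k!`, a sum in `Hom(H, B)` with respect to the topology of
pointwise convergence. -/
def convExp [TopologicalSpace B] {𝒜 : ℕ → Submodule 𝕜 H} (h𝒜 : IsGradedConnected 𝒜)
    (ψ : positivePart 𝒜 →ₗ[𝕜] B) : H →ₗ[𝕜] B :=
  ∑' k : ℕ, (k.factorial : 𝕜)⁻¹ • convPow (extendByZero h𝒜 ψ) k

variable (𝕜 H B)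

/-- The set of `B`-valued characters of `H`. -/
def characters : Set (H →ₗ[𝕜] B) :=
  {φ | (∀ a b : H, φ (a * b) = φ a * φ b) ∧ φ 1 = 1}

/-- The set of `B`-valued infinitesimal characters of `H`. -/
def infinitesimalCharacters : Set (H →ₗ[𝕜] B) :=
  {φ | ∀ a b : H, φ (a * b) =
    Coalgebra.counit (R := 𝕜) b • φ a + Coalgebra.counit (R := 𝕜) a • φ b}

end Hopf

end

noncomputable section

/-! ### The exponential in a filtered algebra -/

section FilteredExp

variable {𝕜 A : Type*} [Field 𝕜] [Ring A] [Algebra 𝕜 A]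

/-! The convolution algebra Hom(H, B) is filtered by the spaces J n of maps vanishing in all degrees
below n. Since Δ respects the grading, this filtration is multiplicative, separated and complete. A
map ψ vanishing on H_0 lies in J 1, so its k-th power lies in J k, and in degree n only the terms k
≤ n of the series survive.

Analyticity needs no estimates. Each power is a polynomial in ψ for a continuous bilinear product,
and such polynomials are closed under directional derivatives (`IsPolynomialMap`). The exponential
is a continuous linear map (`glueExpL`) applied to the sequence of all powers. For 𝕜 = ℝ the same
construction, run on the complexified product and linear maps, gives the holomorphic extension.

The bijection avoids the logarithm. The map φ ↦ exp φ - φ gains one filtration degree, whence exp is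
injective on J 1 (`exp_injective`) and, by iterating to a fixed point, surjective onto 1 + J 1
(`exp_surjective`). To recognise characters, pull back to Hom(H ⊗ H, B) along three coalgebra
morphisms: the multiplication M and the projections p, q given by a ⊗ b ↦ ε(b)a and a ⊗ b ↦ ε(a)b.
Then φ is an infinitesimal character iff M*φ = p*φ + q*φ, and e is multiplicative iff M*e = p*e ⋆
q*e. For commutative B the two pullbacks commute, so exp turns the first equation into the second;
injectivity of exp on H ⊗ H gives the converse. -/

/-- A decreasing, multiplicative and separated filtration of an algebra by subspaces. -/
structure IsSeparatedFiltration (J : ℕ → Submodule 𝕜 A) : Prop where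
  anti : Antitone J
  zero : J 0 = ⊤
  mul : ∀ {m n a b}, a ∈ J m → b ∈ J n → a * b ∈ J (m + n)
  sep : ∀ {a}, (∀ n, a ∈ J n) → a = 0

/-- `e` is the sum of the exponential series of `φ` in the topology defined by `J`, where the
`n`-th partial sum is required to agree with `e` modulo `J n`. -/
def IsFilteredExp (J : ℕ → Submodule 𝕜 A) (φ e : A) : Prop :=
  ∀ n, e - ∑ k ∈ Finset.range n, (k.factorial : 𝕜)⁻¹ • φ ^ k ∈ J n

theorem IsFilteredExp.sub_one_mem {J : ℕ → Submodule 𝕜 A} {φ e : A} (he : IsFilteredExp J φ e) :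
    e - 1 ∈ J 1 := by
  simpa using he 1

namespace IsSeparatedFiltration

variable {J : ℕ → Submodule 𝕜 A} (hJ : IsSeparatedFiltration J)
include hJ

theorem mul_left_mem {n : ℕ} (a : A) {b : A} (hb : b ∈ J n) : a * b ∈ J n := by
  simpa using hJ.mul (m := 0) (a := a) (by simp [hJ.zero]) hb

theorem mul_right_mem {n : ℕ} {a : A} (b : A) (ha : a ∈ J n) : a * b ∈ J n := by
  simpa using hJ.mul (n := 0) (b := b) ha (by simp [hJ.zero])

theorem eq_of_sub_mem {a b : A} (h : ∀ n, a - b ∈ J n) : a = b :=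
  sub_eq_zero.1 (hJ.sep h)

theorem pow_mem {φ : A} (hφ : φ ∈ J 1) (k : ℕ) : φ ^ k ∈ J k := by
  induction k with
  | zero => simp [hJ.zero]
  | succ k ih => rw [pow_succ]; exact hJ.mul ih hφ

/-- In the telescoped difference each summand has one factor φ - φ' and k factors from J 1, each
worth one degree. -/
theorem pow_succ_sub_pow_succ_mem {φ φ' : A} (hφ : φ ∈ J 1) (hφ' : φ' ∈ J 1) {n : ℕ}
    (h : φ - φ' ∈ J n) (k : ℕ) : φ ^ (k + 1) - φ' ^ (k + 1) ∈ J (n + k) := by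
  induction k with
  | zero => simpa using h
  | succ k ih =>
    have : φ ^ (k + 1 + 1) - φ' ^ (k + 1 + 1) =
        φ ^ (k + 1) * (φ - φ') + (φ ^ (k + 1) - φ' ^ (k + 1)) * φ' := by
      rw [pow_succ φ (k + 1), pow_succ φ' (k + 1)]; noncomm_ring
    rw [this]
    refine add_mem ?_ (by simpa [add_assoc] using hJ.mul ih hφ')
    have := hJ.mul (hJ.pow_mem hφ (k + 1)) h
    rwa [add_comm] at this

/-- The map `φ ↦ exp φ - φ` is a contraction. -/
theorem exp_sub_self_sub_mem {φ φ' e e' : A} (hφ : φ ∈ J 1) (hφ' : φ' ∈ J 1)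
    (he : IsFilteredExp J φ e) (he' : IsFilteredExp J φ' e') {n : ℕ} (h : φ - φ' ∈ J n) :
    (e - φ) - (e' - φ') ∈ J (n + 1) := by
  -- Cut both series at n + 2. The constant terms cancel and the linear ones are those subtracted,
  -- so only powers of exponent at least 2 remain, and each of them gains at least one degree.
  have h1 : (e - ∑ k ∈ Finset.range (n + 2), (k.factorial : 𝕜)⁻¹ • φ ^ k) -
      (e' - ∑ k ∈ Finset.range (n + 2), (k.factorial : 𝕜)⁻¹ • φ' ^ k) ∈ J (n + 1) :=
    hJ.anti (by omega) (sub_mem (he (n + 2)) (he' (n + 2)))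
  have h2 : ∑ k ∈ Finset.range n, (((k + 1 + 1).factorial : 𝕜)⁻¹ •
      (φ ^ (k + 1 + 1) - φ' ^ (k + 1 + 1))) ∈ J (n + 1) :=
    sum_mem fun k _ => Submodule.smul_mem _ _
      (hJ.anti (by omega) (hJ.pow_succ_sub_pow_succ_mem hφ hφ' h (k + 1)))
  convert add_mem h1 h2 using 1
  simp only [smul_sub, Finset.sum_sub_distrib, Finset.sum_range_succ' _ (n + 1),
    Finset.sum_range_succ' _ n]
  simp
  abel

/-- With equal exponentials the contraction estimate bounds φ - φ' itself, so agreement modulo J n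
improves to agreement modulo J (n + 1). -/
theorem exp_injective {φ φ' e : A} (hφ : φ ∈ J 1) (hφ' : φ' ∈ J 1)
    (he : IsFilteredExp J φ e) (he' : IsFilteredExp J φ' e) : φ = φ' := by
  refine hJ.eq_of_sub_mem fun n => ?_
  induction n with
  | zero => simp [hJ.zero]
  | succ n ih =>
    have := hJ.exp_sub_self_sub_mem hφ hφ' he he' ih
    rw [sub_sub_sub_cancel_left, ← neg_sub] at this
    exact neg_mem_iff.1 this

theorem exp_unique {φ e e' : A} (he : IsFilteredExp J φ e) (he' : IsFilteredExp J φ e') :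
    e = e' :=
  hJ.eq_of_sub_mem fun n => by simpa using sub_mem (he n) (he' n)

/-- By the binomial theorem the partial sum for φ + φ' is the sum over the triangle i + j < n. It
differs from the product of the exponentials by the two tails and by the rest of the square, all in
J n. -/
theorem exp_add [CharZero 𝕜] {φ φ' e e' : A} (hφ : φ ∈ J 1) (hφ' : φ' ∈ J 1) (hc : Commute φ φ')
    (he : IsFilteredExp J φ e) (he' : IsFilteredExp J φ' e') :
    IsFilteredExp J (φ + φ') (e * e') := by
  intro n
  set a : ℕ → A := fun k => (k.factorial : 𝕜)⁻¹ • φ ^ k with ha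
  set b : ℕ → A := fun k => (k.factorial : 𝕜)⁻¹ • φ' ^ k with hb
  have haJ : ∀ k, a k ∈ J k := fun k => Submodule.smul_mem _ _ (hJ.pow_mem hφ k)
  have hbJ : ∀ k, b k ∈ J k := fun k => Submodule.smul_mem _ _ (hJ.pow_mem hφ' k)
  have key : ∑ k ∈ Finset.range n, (k.factorial : 𝕜)⁻¹ • (φ + φ') ^ k =
      ∑ i ∈ Finset.range n, a i * ∑ j ∈ Finset.range (n - i), b j := by
    simp only [Finset.mul_sum]
    rw [← Finset.sum_range_diag_flip n fun i j => a i * b j]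
    refine Finset.sum_congr rfl fun k _ => ?_
    rw [hc.add_pow', Finset.smul_sum,
      ← Finset.Nat.sum_antidiagonal_eq_sum_range_succ (fun i j => a i * b j)]
    refine Finset.sum_congr rfl fun p hp => ?_
    obtain rfl := Finset.HasAntidiagonal.mem_antidiagonal.1 hp
    simp only [ha, hb, smul_mul_assoc, mul_smul_comm, smul_smul]
    rw [← Nat.cast_smul_eq_nsmul 𝕜, smul_smul]
    congr 1
    have h := congrArg (Nat.cast (R := 𝕜))
      (Nat.add_choose_mul_factorial_mul_factorial p.1 p.2)
    push_cast at h
    have h1 : (p.1.factorial : 𝕜) ≠ 0 := by exact_mod_cast p.1.factorial_ne_zero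
    have h2 : (p.2.factorial : 𝕜) ≠ 0 := by exact_mod_cast p.2.factorial_ne_zero
    have h3 : ((p.1 + p.2).factorial : 𝕜) ≠ 0 := by
      exact_mod_cast (p.1 + p.2).factorial_ne_zero
    field_simp
    rw [← Nat.choose_symm_add] at h
    linear_combination h
  rw [key]
  have h1 : (e - ∑ i ∈ Finset.range n, a i) * e' ∈ J n := hJ.mul_right_mem _ (he n)
  have h2 : (∑ i ∈ Finset.range n, a i) * (e' - ∑ j ∈ Finset.range n, b j) ∈ J n :=
    hJ.mul_left_mem _ (he' n)
  -- The part of the square i, j < n outside the triangle, where i + j ≥ n.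
  have h3 : ∑ i ∈ Finset.range n, a i * (∑ j ∈ Finset.range n, b j -
      ∑ j ∈ Finset.range (n - i), b j) ∈ J n := by
    refine sum_mem fun i _ => ?_
    rw [← Finset.sum_Ico_eq_sub _ (Nat.sub_le n i), Finset.mul_sum]
    refine sum_mem fun j hj => ?_
    have := (Finset.mem_Ico.1 hj).1
    exact hJ.anti (by omega) (hJ.mul (haJ i) (hbJ j))
  convert add_mem (add_mem h1 h2) h3 using 1
  simp only [mul_sub, sub_mul, Finset.sum_sub_distrib, ← Finset.sum_mul]
  abel

/-- If `J` is complete, every element of `1 + J 1` is an exponential. -/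
theorem exp_surjective
    (hcomplete : ∀ s : ℕ → A, (∀ n, s (n + 1) - s n ∈ J (n + 1)) → ∃ t, ∀ n, t - s n ∈ J (n + 1))
    {E : A → A} (hE : ∀ φ ∈ J 1, IsFilteredExp J φ (E φ)) {c : A} (hc : c - 1 ∈ J 1) :
    ∃ φ ∈ J 1, E φ = c := by
  -- The fixed points of this map are the solutions of E φ = c, and it is a contraction on J 1; it
  -- is iterated from 0.
  set T : A → A := fun φ => c - (E φ - φ) with hT
  have hT1 : ∀ φ ∈ J 1, T φ ∈ J 1 := fun φ hφ => by
    have := add_mem (sub_mem hc (hE φ hφ).sub_one_mem) hφ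
    convert this using 1
    simp only [hT]; abel
  have hTc : ∀ φ ∈ J 1, ∀ φ' ∈ J 1, ∀ n, φ - φ' ∈ J n → T φ - T φ' ∈ J (n + 1) :=
    fun φ hφ φ' hφ' n h => by
      have := hJ.exp_sub_self_sub_mem hφ hφ' (hE φ hφ) (hE φ' hφ') h
      rw [← neg_mem_iff] at this
      convert this using 1
      simp only [hT]; abel
  set s : ℕ → A := fun n => T^[n] 0 with hs
  have hs' : ∀ n, s (n + 1) = T (s n) := fun n => Function.iterate_succ_apply' T n 0
  have hs1 : ∀ n, s n ∈ J 1 := fun n => by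
    induction n with
    | zero => simp [hs]
    | succ n ih => rw [hs']; exact hT1 _ ih
  have hsd : ∀ n, s (n + 1) - s n ∈ J (n + 1) := fun n => by
    induction n with
    | zero => exact sub_mem (hs1 _) (hs1 _)
    | succ n ih =>
      rw [hs' (n + 1)]; nth_rw 2 [hs' n]
      exact hTc _ (hs1 _) _ (hs1 _) _ ih
  obtain ⟨t, ht⟩ := hcomplete s hsd
  have ht1 : t ∈ J 1 := by simpa using add_mem (ht 0) (hs1 0)
  refine ⟨t, ht1, (hJ.eq_of_sub_mem fun n => ?_)⟩
  have h1 := hTc t ht1 _ (hs1 n) _ (ht n)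
  rw [← hs'] at h1
  have := hJ.anti (by omega : n ≤ n + 1 + 1) (sub_mem (ht (n + 1)) h1)
  convert this using 1
  simp only [hT]; abel

end IsSeparatedFiltration

theorem IsFilteredExp.map {A' : Type*} [Ring A'] [Algebra 𝕜 A'] {J : ℕ → Submodule 𝕜 A}
    {J' : ℕ → Submodule 𝕜 A'} (L : A →ₐ[𝕜] A') (hL : ∀ n, ∀ a ∈ J n, L a ∈ J' n) {φ e : A}
    (he : IsFilteredExp J φ e) : IsFilteredExp J' (L φ) (L e) := fun n => by
  simpa using hL n _ (he n)

end FilteredExp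

end

noncomputable section

/-! ### Graded coalgebras and the filtration of the convolution algebra -/

section GradedCoalgebra

variable {𝕜 C D B : Type*} [Field 𝕜] [AddCommGroup C] [Module 𝕜 C] [AddCommGroup D] [Module 𝕜 D]
  [Ring B] [Algebra 𝕜 B]

/-- The total grading of a tensor product of graded vector spaces. -/
def tensorGrading (𝒞 : ℕ → Submodule 𝕜 C) (𝒟 : ℕ → Submodule 𝕜 D) (n : ℕ) :
    Submodule 𝕜 (C ⊗[𝕜] D) :=
  ⨆ (p : ℕ × ℕ) (_ : p.1 + p.2 = n),
    LinearMap.range (TensorProduct.map (𝒞 p.1).subtype (𝒟 p.2).subtype)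

theorem tensorGrading_le {𝒞 : ℕ → Submodule 𝕜 C} {𝒟 : ℕ → Submodule 𝕜 D} {n : ℕ}
    {S : Submodule 𝕜 (C ⊗[𝕜] D)}
    (h : ∀ p q, p + q = n → ∀ a ∈ 𝒞 p, ∀ b ∈ 𝒟 q, a ⊗ₜ[𝕜] b ∈ S) : tensorGrading 𝒞 𝒟 n ≤ S := by
  refine iSup₂_le fun p hp => ?_
  rintro _ ⟨t, rfl⟩
  induction t with
  | zero => simp
  | add x y hx hy => rw [map_add]; exact add_mem hx hy
  | tmul a b => exact h p.1 p.2 hp _ a.2 _ b.2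

theorem tmul_mem_tensorGrading {𝒞 : ℕ → Submodule 𝕜 C} {𝒟 : ℕ → Submodule 𝕜 D} {p q n : ℕ}
    (hn : p + q = n) {a : C} (ha : a ∈ 𝒞 p) {b : D} (hb : b ∈ 𝒟 q) :
    a ⊗ₜ[𝕜] b ∈ tensorGrading 𝒞 𝒟 n :=
  Submodule.mem_iSup_of_mem (p, q) (Submodule.mem_iSup_of_mem hn
    ⟨(⟨a, ha⟩ : 𝒞 p) ⊗ₜ (⟨b, hb⟩ : 𝒟 q), rfl⟩)

/-- The subspaces `𝒞 n` span `C` and are compatible with the comultiplication. -/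
structure IsGradedCoalgebra [Coalgebra 𝕜 C] (𝒞 : ℕ → Submodule 𝕜 C) : Prop where
  iSup_eq_top : ⨆ n, 𝒞 n = ⊤
  comul_mem : ∀ n, ∀ a ∈ 𝒞 n, Coalgebra.comul (R := 𝕜) a ∈ tensorGrading 𝒞 𝒞 n

namespace IsGradedCoalgebra

variable [Coalgebra 𝕜 C] [Coalgebra 𝕜 D] {𝒞 : ℕ → Submodule 𝕜 C} {𝒟 : ℕ → Submodule 𝕜 D}

theorem induction (h𝒞 : IsGradedCoalgebra 𝒞) {P : C → Prop} (x : C)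
    (mem : ∀ n, ∀ a ∈ 𝒞 n, P a) (add : ∀ a b, P a → P b → P (a + b)) : P x :=
  Submodule.iSup_induction 𝒞 (motive := P) (h𝒞.iSup_eq_top ▸ Submodule.mem_top) mem
    (mem 0 0 (zero_mem _)) add

/-- This makes the filtered theory available on H ⊗ H. The middle swap regroups degrees (p₁ + p₂) +
(q₁ + q₂) as (p₁ + q₁) + (p₂ + q₂). -/
protected theorem tensor (h𝒞 : IsGradedCoalgebra 𝒞) (h𝒟 : IsGradedCoalgebra 𝒟) :
    IsGradedCoalgebra (tensorGrading 𝒞 𝒟) where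
  iSup_eq_top := by
    refine Submodule.eq_top_iff'.2 fun t => ?_
    induction t with
    | zero => exact zero_mem _
    | add x y hx hy => exact add_mem hx hy
    | tmul a b =>
      induction a using h𝒞.induction with
      | add a a' ha ha' => rw [TensorProduct.add_tmul]; exact add_mem ha ha'
      | mem p a ha =>
        induction b using h𝒟.induction with
        | add b b' hb hb' => rw [TensorProduct.tmul_add]; exact add_mem hb hb'
        | mem q b hb =>
          exact Submodule.mem_iSup_of_mem (p + q) (tmul_mem_tensorGrading rfl ha hb)
  comul_mem n := by
    refine tensorGrading_le (S := (tensorGrading (tensorGrading 𝒞 𝒟) (tensorGrading 𝒞 𝒟) n).comap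
      (Coalgebra.comul (R := 𝕜) (A := C ⊗[𝕜] D))) fun p q hpq a ha b hb => ?_
    rw [Submodule.mem_comap, TensorProduct.comul_tmul]
    -- The claim is linear in each coproduct separately, so each may be replaced by a homogeneous
    -- pure tensor.
    generalize hu : Coalgebra.comul (R := 𝕜) a = u
    generalize hv : Coalgebra.comul (R := 𝕜) b = v
    have hu' := hu ▸ h𝒞.comul_mem p a ha
    have hv' := hv ▸ h𝒟.comul_mem q b hb
    clear hu hv ha hb
    set τ := TensorProduct.AlgebraTensorModule.tensorTensorTensorComm 𝕜 𝕜 𝕜 𝕜 C C D D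
    refine tensorGrading_le (S := (tensorGrading (tensorGrading 𝒞 𝒟) (tensorGrading 𝒞 𝒟) n).comap
      (τ.toLinearMap ∘ₗ (TensorProduct.mk 𝕜 _ _).flip v)) ?_ hu'
    intro p₁ p₂ hp a₁ ha₁ a₂ ha₂
    refine tensorGrading_le (S := (tensorGrading (tensorGrading 𝒞 𝒟) (tensorGrading 𝒞 𝒟) n).comap
      (τ.toLinearMap ∘ₗ TensorProduct.mk 𝕜 _ _ (a₁ ⊗ₜ a₂))) ?_ hv'
    intro q₁ q₂ hq b₁ hb₁ b₂ hb₂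
    exact tmul_mem_tensorGrading (p := p₁ + q₁) (q := p₂ + q₂) (by omega)
      (tmul_mem_tensorGrading rfl ha₁ hb₁) (tmul_mem_tensorGrading rfl ha₂ hb₂)

end IsGradedCoalgebra

/-- The space of linear maps which vanish in all degrees less than `n`. -/
def vanishingBelow (𝒞 : ℕ → Submodule 𝕜 C) (B : Type*) [Ring B] [Algebra 𝕜 B] (n : ℕ) :
    Submodule 𝕜 (WithConv (C →ₗ[𝕜] B)) where
  carrier := {f | ∀ p < n, ∀ a ∈ 𝒞 p, f a = 0}
  zero_mem' := fun _ _ _ _ => rfl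
  add_mem' := fun {f g} hf hg p hp a ha => by
    change f a + g a = 0
    rw [hf p hp a ha, hg p hp a ha, add_zero]
  smul_mem' := fun c f hf p hp a ha => by
    change c • f a = 0
    rw [hf p hp a ha, smul_zero]

theorem vanishingBelow_anti (𝒞 : ℕ → Submodule 𝕜 C) : Antitone (vanishingBelow 𝒞 B) :=
  fun _ _ hmn _ hf p hp => hf p (hp.trans_le hmn)

/-- For multiplicativity: if q + r < m + n then q < m or r < n, so every term of the convolution has
a vanishing factor. -/
theorem IsGradedCoalgebra.isSeparatedFiltration [Coalgebra 𝕜 C] {𝒞 : ℕ → Submodule 𝕜 C}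
    (h𝒞 : IsGradedCoalgebra 𝒞) : IsSeparatedFiltration (vanishingBelow 𝒞 B) where
  anti := vanishingBelow_anti 𝒞
  zero := eq_top_iff.2 fun _ _ p hp => absurd hp (Nat.not_lt_zero p)
  mul {m n f g} hf hg p hp a ha := by
    rw [LinearMap.convMul_apply]
    refine tensorGrading_le (S := LinearMap.ker (LinearMap.mul' 𝕜 B ∘ₗ
      TensorProduct.map f.ofConv g.ofConv)) ?_ (h𝒞.comul_mem p a ha)
    intro q r hqr a ha b hb
    change f a * g b = 0
    by_cases hq : q < m
    · rw [hf q hq a ha, zero_mul]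
    · rw [hg r (by omega) b hb, mul_zero]
  sep {f} hf := by
    ext x
    induction x using h𝒞.induction with
    | mem n a ha => exact hf (n + 1) n n.lt_succ_self a ha
    | add a b ha hb => simpa using congrArg₂ (· + ·) ha hb

/-- Precomposition with a morphism of coalgebras is a morphism of convolution algebras. -/
def convComp [Coalgebra 𝕜 C] [Coalgebra 𝕜 D] (B : Type*) [Ring B] [Algebra 𝕜 B] (h : C →ₗc[𝕜] D) :
    WithConv (D →ₗ[𝕜] B) →ₐ[𝕜] WithConv (C →ₗ[𝕜] B) :=
  AlgHom.ofLinearMap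
    { toFun := fun f => WithConv.toConv (f.ofConv ∘ₗ h.toLinearMap)
      map_add' := fun _ _ => rfl
      map_smul' := fun _ _ => rfl }
    (by
      ext x
      change algebraMap 𝕜 B (Coalgebra.counit (h x)) = algebraMap 𝕜 B (Coalgebra.counit x)
      rw [CoalgHomClass.counit_comp_apply])
    (fun f g => congrArg WithConv.toConv (LinearMap.convMul_comp_coalgHom_distrib f g h))

theorem convComp_apply [Coalgebra 𝕜 C] [Coalgebra 𝕜 D] (h : C →ₗc[𝕜] D)
    (f : WithConv (D →ₗ[𝕜] B)) (x : C) : convComp B h f x = f (h x) := rfl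

/-- The morphism may lower degrees: the projections of H ⊗ H send bidegree (p, q) to degree p or q,
not p + q. -/
theorem convComp_mem [Coalgebra 𝕜 C] [Coalgebra 𝕜 D] {𝒞 : ℕ → Submodule 𝕜 C}
    {𝒟 : ℕ → Submodule 𝕜 D} {h : C →ₗc[𝕜] D}
    (hh : ∀ n, 𝒞 n ≤ (⨆ m ∈ Set.Iic n, 𝒟 m).comap h.toLinearMap) (n : ℕ)
    (f : WithConv (D →ₗ[𝕜] B)) (hf : f ∈ vanishingBelow 𝒟 B n) :
    convComp B h f ∈ vanishingBelow 𝒞 B n := fun p hp a ha => by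
  have : ⨆ m ∈ Set.Iic p, 𝒟 m ≤ LinearMap.ker f.ofConv :=
    iSup₂_le fun m hm b hb => hf m (lt_of_le_of_lt hm hp) b hb
  exact this (hh p ha)

/-- The linear map given on the `n`-th summand of an internal direct sum by `w n`. -/
def glue {𝒞 : ℕ → Submodule 𝕜 C} (h : DirectSum.IsInternal 𝒞) (w : ℕ → C →ₗ[𝕜] B) : C →ₗ[𝕜] B :=
  DirectSum.toModule 𝕜 ℕ B (fun n => w n ∘ₗ (𝒞 n).subtype) ∘ₗ
    (LinearEquiv.ofBijective (DirectSum.coeLinearMap 𝒞) h).symm.toLinearMap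

theorem glue_apply {𝒞 : ℕ → Submodule 𝕜 C} (h : DirectSum.IsInternal 𝒞) (w : ℕ → C →ₗ[𝕜] B)
    {n : ℕ} {a : C} (ha : a ∈ 𝒞 n) : glue h w a = w n a := by
  have h1 : (LinearEquiv.ofBijective (DirectSum.coeLinearMap 𝒞) h).symm a =
      DirectSum.lof 𝕜 ℕ (fun n => 𝒞 n) n ⟨a, ha⟩ :=
    (LinearEquiv.symm_apply_eq _).2 (DirectSum.coeLinearMap_lof 𝒞 n ⟨a, ha⟩).symm
  change DirectSum.toModule 𝕜 ℕ B (fun n => w n ∘ₗ (𝒞 n).subtype)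
    ((LinearEquiv.ofBijective (DirectSum.coeLinearMap 𝒞) h).symm a) = w n a
  rw [h1, DirectSum.toModule_lof]
  rfl

/-- The sum `∑_k w_k / k!`, taken over `k ≤ n` in degree `n`. -/
def glueExp {𝒞 : ℕ → Submodule 𝕜 C} (h : DirectSum.IsInternal 𝒞) (w : ℕ → C →ₗ[𝕜] B) :
    C →ₗ[𝕜] B :=
  glue h fun n => ∑ k ∈ Finset.range (n + 1), (k.factorial : 𝕜)⁻¹ • w k

theorem glueExp_apply {𝒞 : ℕ → Submodule 𝕜 C} (h : DirectSum.IsInternal 𝒞) (w : ℕ → C →ₗ[𝕜] B)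
    {n : ℕ} {a : C} (ha : a ∈ 𝒞 n) :
    glueExp h w a = ∑ k ∈ Finset.range (n + 1), (k.factorial : 𝕜)⁻¹ • w k a := by
  simp [glueExp, glue_apply h _ ha]

theorem isFilteredExp_glueExp [Coalgebra 𝕜 C] {𝒞 : ℕ → Submodule 𝕜 C} (h𝒞 : IsGradedCoalgebra 𝒞)
    (h : DirectSum.IsInternal 𝒞) {φ : WithConv (C →ₗ[𝕜] B)} (hφ : φ ∈ vanishingBelow 𝒞 B 1) :
    IsFilteredExp (vanishingBelow 𝒞 B) φ (WithConv.toConv (glueExp h fun k => (φ ^ k).ofConv)) := by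
  intro n p hp a ha
  have h1 : (∑ k ∈ Finset.range n, (k.factorial : 𝕜)⁻¹ • φ ^ k) a =
      ∑ k ∈ Finset.range n, (k.factorial : 𝕜)⁻¹ • (φ ^ k) a := by
    simp
  change glueExp h _ a - (∑ k ∈ Finset.range n, (k.factorial : 𝕜)⁻¹ • φ ^ k) a = 0
  rw [h1, glueExp_apply h _ ha, sub_eq_zero]
  refine Finset.sum_subset (Finset.range_mono hp) fun k _ hk => ?_
  rw [h𝒞.isSeparatedFiltration.pow_mem hφ k p (by simpa using hk) a ha, smul_zero]

/-- Completeness of the filtration: in degree p the sequence is constant from index p on, so the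
limit can be read off from `s p` there. -/
theorem exists_sub_mem_vanishingBelow {𝒞 : ℕ → Submodule 𝕜 C} (h : DirectSum.IsInternal 𝒞)
    (s : ℕ → WithConv (C →ₗ[𝕜] B)) (hs : ∀ n, s (n + 1) - s n ∈ vanishingBelow 𝒞 B (n + 1)) :
    ∃ t, ∀ n, t - s n ∈ vanishingBelow 𝒞 B (n + 1) := by
  refine ⟨WithConv.toConv (glue h fun n => (s n).ofConv), fun n p hp a ha => ?_⟩
  change glue h _ a - s n a = 0
  rw [glue_apply h _ ha]
  induction n, Nat.lt_succ_iff.1 hp using Nat.le_induction with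
  | base => exact sub_self _
  | succ n hn ih =>
    have h1 := ih (by omega)
    have h2 : s (n + 1) a - s n a = 0 := hs n p (by omega) a ha
    rw [sub_eq_zero] at h1 h2 ⊢
    rw [h2, h1]

end GradedCoalgebra

end

noncomputable section

/-! ### Characters and infinitesimal characters -/

section ConvolutionOnTensorSquare

variable {𝕜 H B : Type*} [Field 𝕜] [Ring H] [Bialgebra 𝕜 H] [Ring B] [Algebra 𝕜 B]

variable (𝕜 H) in
/-- The morphism of coalgebras `a ⊗ b ↦ ε(b) a`. -/
def tensorFst : H ⊗[𝕜] H →ₗc[𝕜] H :=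
  (Coalgebra.TensorProduct.rid 𝕜 𝕜 H : H ⊗[𝕜] 𝕜 →ₗc[𝕜] H).comp
    (Coalgebra.TensorProduct.map (CoalgHom.id 𝕜 H) (Coalgebra.counitCoalgHom 𝕜 H))

variable (𝕜 H) in
/-- The morphism of coalgebras `a ⊗ b ↦ ε(a) b`. -/
def tensorSnd : H ⊗[𝕜] H →ₗc[𝕜] H :=
  (Coalgebra.TensorProduct.lid 𝕜 H : 𝕜 ⊗[𝕜] H →ₗc[𝕜] H).comp
    (Coalgebra.TensorProduct.map (Coalgebra.counitCoalgHom 𝕜 H) (CoalgHom.id 𝕜 H))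

theorem tensorFst_tmul (a b : H) :
    tensorFst 𝕜 H (a ⊗ₜ b) = Coalgebra.counit (R := 𝕜) b • a := rfl

theorem tensorSnd_tmul (a b : H) :
    tensorSnd 𝕜 H (a ⊗ₜ b) = Coalgebra.counit (R := 𝕜) a • b := rfl

theorem convComp_fst_tmul (f : WithConv (H →ₗ[𝕜] B)) (a b : H) :
    convComp B (tensorFst 𝕜 H) f (a ⊗ₜ b) = Coalgebra.counit (R := 𝕜) b • f a := by
  rw [convComp_apply, tensorFst_tmul, map_smul]

theorem convComp_snd_tmul (f : WithConv (H →ₗ[𝕜] B)) (a b : H) :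
    convComp B (tensorSnd 𝕜 H) f (a ⊗ₜ b) = Coalgebra.counit (R := 𝕜) a • f b := by
  rw [convComp_apply, tensorSnd_tmul, map_smul]

theorem convComp_mul_tmul (f : WithConv (H →ₗ[𝕜] B)) (a b : H) :
    convComp B (Bialgebra.mulCoalgHom 𝕜 H) f (a ⊗ₜ b) = f (a * b) := rfl

/-- In Sweedler notation the value is Σ ε(b₁) f(a₁) ε(a₂) g(b₂), which is (f ⋆ 1)(a) (1 ⋆ g)(b). -/
theorem fst_mul_snd_tmul (f g : WithConv (H →ₗ[𝕜] B)) (a b : H) :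
    (convComp B (tensorFst 𝕜 H) f * convComp B (tensorSnd 𝕜 H) g) (a ⊗ₜ b) = f a * g b := by
  -- Stated for arbitrary tensors in place of the coproducts of a and b, so that induction reduces
  -- it to pure tensors.
  have key : ∀ u v : H ⊗[𝕜] H,
      LinearMap.mul' 𝕜 B (TensorProduct.map (convComp B (tensorFst 𝕜 H) f).ofConv
        (convComp B (tensorSnd 𝕜 H) g).ofConv
        (TensorProduct.AlgebraTensorModule.tensorTensorTensorComm 𝕜 𝕜 𝕜 𝕜 H H H H (u ⊗ₜ v))) =
      LinearMap.mul' 𝕜 B (TensorProduct.map f.ofConv (1 : WithConv (H →ₗ[𝕜] B)).ofConv u) *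
      LinearMap.mul' 𝕜 B (TensorProduct.map (1 : WithConv (H →ₗ[𝕜] B)).ofConv g.ofConv v) := by
    intro u v
    induction u with
    | zero => simp
    | add x y hx hy => simp only [TensorProduct.add_tmul, map_add, add_mul, hx, hy]
    | tmul a₁ a₂ =>
      induction v with
      | zero => simp
      | add x y hx hy => simp only [TensorProduct.tmul_add, map_add, mul_add, hx, hy]
      | tmul b₁ b₂ =>
        change convComp B (tensorFst 𝕜 H) f (a₁ ⊗ₜ b₁) * convComp B (tensorSnd 𝕜 H) g (a₂ ⊗ₜ b₂) =
          (f a₁ * algebraMap 𝕜 B (Coalgebra.counit a₂)) *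
            (algebraMap 𝕜 B (Coalgebra.counit b₁) * g b₂)
        rw [convComp_fst_tmul, convComp_snd_tmul, ← Algebra.commutes, ← Algebra.smul_def,
          ← Algebra.smul_def]
        simp only [smul_mul_smul_comm, mul_comm]
  rw [LinearMap.convMul_apply, TensorProduct.comul_tmul, key, ← LinearMap.convMul_apply,
    ← LinearMap.convMul_apply, mul_one, one_mul]

theorem snd_mul_fst_tmul (f g : WithConv (H →ₗ[𝕜] B)) (a b : H) :
    (convComp B (tensorSnd 𝕜 H) g * convComp B (tensorFst 𝕜 H) f) (a ⊗ₜ b) = g b * f a := by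
  have key : ∀ u v : H ⊗[𝕜] H,
      LinearMap.mul' 𝕜 B (TensorProduct.map (convComp B (tensorSnd 𝕜 H) g).ofConv
        (convComp B (tensorFst 𝕜 H) f).ofConv
        (TensorProduct.AlgebraTensorModule.tensorTensorTensorComm 𝕜 𝕜 𝕜 𝕜 H H H H (u ⊗ₜ v))) =
      LinearMap.mul' 𝕜 B (TensorProduct.map g.ofConv (1 : WithConv (H →ₗ[𝕜] B)).ofConv v) *
      LinearMap.mul' 𝕜 B (TensorProduct.map (1 : WithConv (H →ₗ[𝕜] B)).ofConv f.ofConv u) := by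
    intro u v
    induction u with
    | zero => simp
    | add x y hx hy => simp only [TensorProduct.add_tmul, map_add, mul_add, hx, hy]
    | tmul a₁ a₂ =>
      induction v with
      | zero => simp
      | add x y hx hy => simp only [TensorProduct.tmul_add, map_add, add_mul, hx, hy]
      | tmul b₁ b₂ =>
        change convComp B (tensorSnd 𝕜 H) g (a₁ ⊗ₜ b₁) * convComp B (tensorFst 𝕜 H) f (a₂ ⊗ₜ b₂) =
          (g b₁ * algebraMap 𝕜 B (Coalgebra.counit b₂)) *
            (algebraMap 𝕜 B (Coalgebra.counit a₁) * f a₂)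
        rw [convComp_fst_tmul, convComp_snd_tmul, ← Algebra.commutes, ← Algebra.smul_def,
          ← Algebra.smul_def]
        simp only [smul_mul_smul_comm, mul_comm]
  rw [LinearMap.convMul_apply, TensorProduct.comul_tmul, key, ← LinearMap.convMul_apply,
    ← LinearMap.convMul_apply, mul_one, one_mul]

theorem withConv_tensor_ext {F G : WithConv (H ⊗[𝕜] H →ₗ[𝕜] B)}
    (h : ∀ a b, F (a ⊗ₜ b) = G (a ⊗ₜ b)) : F = G :=
  congrArg WithConv.toConv (TensorProduct.ext' (g := F.ofConv) (h := G.ofConv) h)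

end ConvolutionOnTensorSquare

/-! ### Connectedness and the characterisation of characters on H ⊗ H -/

section Connected

variable {𝕜 H B : Type*} [RCLike 𝕜] [Ring H] [HopfAlgebra 𝕜 H] [Ring B] [Algebra 𝕜 B]
  {𝒜 : ℕ → Submodule 𝕜 H}

namespace IsGradedConnected

theorem isGradedCoalgebra (h𝒜 : IsGradedConnected 𝒜) : IsGradedCoalgebra 𝒜 where
  iSup_eq_top := h𝒜.isInternal.submodule_iSup_eq_top
  comul_mem := h𝒜.comul_mem

/-- The grading axioms do not include this. Comparing homogeneous components in 1 · a = a shows that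
the degree-zero component of 1 is a left unit, hence equal to 1. -/
theorem one_mem (h𝒜 : IsGradedConnected 𝒜) : (1 : H) ∈ 𝒜 0 := by
  have hG := h𝒜.isGradedCoalgebra
  set P : ℕ → H →ₗ[𝕜] H := fun m =>
    glue h𝒜.isInternal fun k => if k = m then LinearMap.id else 0 with hP
  have hP_apply : ∀ m k, ∀ a ∈ 𝒜 k, P m a = if k = m then a else 0 := fun m k a ha => by
    simp only [hP, glue_apply _ _ ha]
    split <;> rfl
  have hmul : ∀ m, ∀ a ∈ 𝒜 m, ∀ x : H, P m (x * a) = P 0 x * a := fun m a ha x => by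
    induction x using hG.induction with
    | add x y hx hy => rw [add_mul, map_add, map_add, add_mul, hx, hy]
    | mem k x hx =>
      rw [hP_apply m (k + m) _ (h𝒜.mul_mem k m x hx a ha), hP_apply 0 k x hx]
      simp
  have hleft : ∀ x : H, P 0 1 * x = x := fun x => by
    induction x using hG.induction with
    | add x y hx hy => rw [mul_add, hx, hy]
    | mem k x hx => rw [← hmul k x hx 1, one_mul, hP_apply k k x hx, if_pos rfl]
  have hmem : ∀ x : H, P 0 x ∈ 𝒜 0 := fun x => by
    induction x using hG.induction with
    | add x y hx hy => rw [map_add]; exact add_mem hx hy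
    | mem k x hx =>
      rw [hP_apply 0 k x hx]
      split
      · next h => exact h ▸ hx
      · exact zero_mem _
  have := hmem 1
  rwa [← mul_one (P 0 1), hleft] at this

theorem exists_eq_smul_one (h𝒜 : IsGradedConnected 𝒜) {a : H} (ha : a ∈ 𝒜 0) :
    ∃ c : 𝕜, a = c • (1 : H) := by
  obtain ⟨e⟩ := h𝒜.connected
  have h1 : (1 : H) ≠ 0 := fun h => by
    have := Bialgebra.counit_one (R := 𝕜) (A := H)
    rw [h, map_zero] at this
    exact zero_ne_one this
  have he : e ⟨1, h𝒜.one_mem⟩ ≠ 0 := fun h => h1 <| by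
    simpa using h
  refine ⟨e ⟨a, ha⟩ / e ⟨1, h𝒜.one_mem⟩, ?_⟩
  have : (⟨a, ha⟩ : 𝒜 0) = (e ⟨a, ha⟩ / e ⟨1, h𝒜.one_mem⟩) • ⟨1, h𝒜.one_mem⟩ :=
    e.injective (by rw [map_smul, smul_eq_mul, div_mul_cancel₀ _ he])
  exact congrArg Subtype.val this

theorem mem_vanishingBelow_one (h𝒜 : IsGradedConnected 𝒜) {f : WithConv (H →ₗ[𝕜] B)}
    (hf : f 1 = 0) : f ∈ vanishingBelow 𝒜 B 1 := fun p hp a ha => by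
  obtain rfl : p = 0 := by omega
  obtain ⟨c, rfl⟩ := h𝒜.exists_eq_smul_one ha
  rw [map_smul, hf, smul_zero]

theorem apply_one_of_mem (h𝒜 : IsGradedConnected 𝒜) {f : WithConv (H →ₗ[𝕜] B)}
    (hf : f ∈ vanishingBelow 𝒜 B 1) : f 1 = 0 :=
  hf 0 one_pos 1 h𝒜.one_mem

theorem extendByZero_mem (h𝒜 : IsGradedConnected 𝒜) (ψ : positivePart 𝒜 →ₗ[𝕜] B) :
    WithConv.toConv (extendByZero h𝒜 ψ) ∈ vanishingBelow 𝒜 B 1 := fun p hp a ha => by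
  obtain rfl : p = 0 := by omega
  change ψ ((positivePart 𝒜).projectionOnto (𝒜 0) h𝒜.isCompl a) = 0
  rw [(Submodule.projectionOnto_apply_eq_zero_iff h𝒜.isCompl).2 ha, map_zero]

theorem extendByZero_apply_coe (h𝒜 : IsGradedConnected 𝒜) (ψ : positivePart 𝒜 →ₗ[𝕜] B)
    (x : positivePart 𝒜) : extendByZero h𝒜 ψ x = ψ x := by
  change ψ ((positivePart 𝒜).projectionOnto (𝒜 0) h𝒜.isCompl x) = ψ x
  rw [Submodule.projectionOnto_apply_left]

theorem extendByZero_injective (h𝒜 : IsGradedConnected 𝒜) :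
    Function.Injective (extendByZero h𝒜 : _ → H →ₗ[𝕜] B) := fun ψ ψ' h => by
  ext x
  rw [← h𝒜.extendByZero_apply_coe, h, h𝒜.extendByZero_apply_coe]

theorem extendByZero_restrict (h𝒜 : IsGradedConnected 𝒜) {f : H →ₗ[𝕜] B}
    (hf : WithConv.toConv f ∈ vanishingBelow 𝒜 B 1) :
    extendByZero h𝒜 (f ∘ₗ (positivePart 𝒜).subtype) = f := by
  ext x
  obtain ⟨y, hy, z, hz, rfl⟩ := Submodule.mem_sup.1
    (h𝒜.isCompl.sup_eq_top ▸ Submodule.mem_top : x ∈ positivePart 𝒜 ⊔ 𝒜 0)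
  have h1 : extendByZero h𝒜 (f ∘ₗ (positivePart 𝒜).subtype) z = 0 :=
    h𝒜.extendByZero_mem _ 0 one_pos z hz
  have h2 : f z = 0 := hf 0 one_pos z hz
  rw [map_add, map_add, h1, h2]
  exact congrArg (· + 0) (h𝒜.extendByZero_apply_coe _ ⟨y, hy⟩)

theorem mul_compatible (h𝒜 : IsGradedConnected 𝒜) (n : ℕ) :
    tensorGrading 𝒜 𝒜 n ≤ (⨆ m ∈ Set.Iic n, 𝒜 m).comap
      (Bialgebra.mulCoalgHom 𝕜 H).toLinearMap :=
  tensorGrading_le fun p q hpq a ha b hb =>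
    Submodule.mem_iSup_of_mem n (Submodule.mem_iSup_of_mem (Set.mem_Iic.2 le_rfl)
      (hpq ▸ h𝒜.mul_mem p q a ha b hb))

end IsGradedConnected

theorem tensorFst_compatible (𝒜 : ℕ → Submodule 𝕜 H) (n : ℕ) :
    tensorGrading 𝒜 𝒜 n ≤ (⨆ m ∈ Set.Iic n, 𝒜 m).comap (tensorFst 𝕜 H).toLinearMap :=
  tensorGrading_le fun p q hpq a ha b _ =>
    Submodule.mem_iSup_of_mem p (Submodule.mem_iSup_of_mem (Set.mem_Iic.2 (by omega))
      (Submodule.smul_mem _ (Coalgebra.counit (R := 𝕜) b) ha))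

theorem tensorSnd_compatible (𝒜 : ℕ → Submodule 𝕜 H) (n : ℕ) :
    tensorGrading 𝒜 𝒜 n ≤ (⨆ m ∈ Set.Iic n, 𝒜 m).comap (tensorSnd 𝕜 H).toLinearMap :=
  tensorGrading_le fun p q hpq a _ b hb =>
    Submodule.mem_iSup_of_mem q (Submodule.mem_iSup_of_mem (Set.mem_Iic.2 (by omega))
      (Submodule.smul_mem _ (Coalgebra.counit (R := 𝕜) a) hb))

theorem infinitesimalCharacters_apply_one {φ : H →ₗ[𝕜] B}
    (hφ : φ ∈ infinitesimalCharacters 𝕜 H B) : φ 1 = 0 := by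
  -- This reads φ(1) = φ(1) + φ(1).
  have := hφ 1 1
  simpa using this

theorem mem_infinitesimalCharacters_iff {φ : WithConv (H →ₗ[𝕜] B)} :
    φ.ofConv ∈ infinitesimalCharacters 𝕜 H B ↔
      convComp B (Bialgebra.mulCoalgHom 𝕜 H) φ =
        convComp B (tensorFst 𝕜 H) φ + convComp B (tensorSnd 𝕜 H) φ := by
  have h (a b : H) : (convComp B (tensorFst 𝕜 H) φ + convComp B (tensorSnd 𝕜 H) φ) (a ⊗ₜ b) =
      Coalgebra.counit (R := 𝕜) b • φ a + Coalgebra.counit (R := 𝕜) a • φ b :=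
    congrArg₂ (· + ·) (convComp_fst_tmul φ a b) (convComp_snd_tmul φ a b)
  refine ⟨fun hφ => withConv_tensor_ext fun a b => ?_, fun hφ a b => ?_⟩
  · rw [h, convComp_mul_tmul]; exact hφ a b
  · rw [← h, ← hφ, convComp_mul_tmul]

theorem mul_eq_iff {e : WithConv (H →ₗ[𝕜] B)} :
    (∀ a b, e (a * b) = e a * e b) ↔ convComp B (Bialgebra.mulCoalgHom 𝕜 H) e =
      convComp B (tensorFst 𝕜 H) e * convComp B (tensorSnd 𝕜 H) e := by
  refine ⟨fun he => withConv_tensor_ext fun a b => ?_, fun he a b => ?_⟩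
  · rw [fst_mul_snd_tmul, convComp_mul_tmul, he]
  · rw [← fst_mul_snd_tmul, ← he, convComp_mul_tmul]

theorem commute_fst_snd (hB : ∀ a b : B, a * b = b * a) (f g : WithConv (H →ₗ[𝕜] B)) :
    Commute (convComp B (tensorFst 𝕜 H) f) (convComp B (tensorSnd 𝕜 H) g) :=
  withConv_tensor_ext fun a b => by rw [fst_mul_snd_tmul, snd_mul_fst_tmul, hB]

/-- The exponential of `φ` is a character if and only if `φ` is an infinitesimal character. -/
theorem IsGradedConnected.exp_mem_characters_iff (h𝒜 : IsGradedConnected 𝒜)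
    (hB : ∀ a b : B, a * b = b * a) {φ e : WithConv (H →ₗ[𝕜] B)}
    (hφ : φ ∈ vanishingBelow 𝒜 B 1) (he : IsFilteredExp (vanishingBelow 𝒜 B) φ e) :
    e.ofConv ∈ characters 𝕜 H B ↔ φ.ofConv ∈ infinitesimalCharacters 𝕜 H B := by
  have hJ := (h𝒜.isGradedCoalgebra.tensor h𝒜.isGradedCoalgebra).isSeparatedFiltration (B := B)
  have hfst := convComp_mem (B := B) (tensorFst_compatible 𝒜)
  have hsnd := convComp_mem (B := B) (tensorSnd_compatible 𝒜)
  have hmul := convComp_mem (B := B) h𝒜.mul_compatible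
  have hadd := hJ.exp_add (hfst 1 φ hφ) (hsnd 1 φ hφ) (commute_fst_snd hB φ φ)
    (he.map _ hfst) (he.map _ hsnd)
  -- Unitality is automatic since e lies in 1 + J 1; only multiplicativity is at stake.
  have hone : e 1 = 1 := by
    have : e 1 - (1 : WithConv (H →ₗ[𝕜] B)) 1 = 0 := h𝒜.apply_one_of_mem he.sub_one_mem
    rw [sub_eq_zero.1 this, LinearMap.convOne_apply, Bialgebra.counit_one, map_one]
  have hchar : e.ofConv ∈ characters 𝕜 H B ↔ ∀ a b, e (a * b) = e a * e b :=
    ⟨fun h => h.1, fun h => ⟨h, hone⟩⟩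
  rw [hchar, mul_eq_iff, mem_infinitesimalCharacters_iff]
  -- Pullback along the multiplication commutes with exp, so this exponential can be compared with
  -- the one in `hadd`.
  have hM := he.map _ hmul
  constructor
  · intro h
    rw [h] at hM
    exact hJ.exp_injective (hmul 1 φ hφ) (add_mem (hfst 1 φ hφ) (hsnd 1 φ hφ)) hM hadd
  · intro h
    rw [h] at hM
    exact hJ.exp_unique hM hadd

end Connected

end

noncomputable section

/-! ### Smoothness of polynomial maps -/

section Smooth

variable {K E F G : Type*} [RCLike K] [AddCommGroup E] [Module K E] [AddCommGroup F] [Module K F]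

section

variable [TopologicalSpace F]

theorem IsBastianiSmoothOn.clm_comp [TopologicalSpace E] [AddCommGroup G] [TopologicalSpace G]
    [Module K G] {U : Set E} {f : E → F} (hf : IsBastianiSmoothOn K U f)
    (L : F →L[K] G) : IsBastianiSmoothOn K U fun x => L (f x) := by
  obtain ⟨d, h0, h1, h2⟩ := hf
  refine ⟨fun k x y => L (d k x y), fun x hx => congrArg L (h0 x hx), fun k x hx y h => ?_,
    fun k => L.continuous.comp_continuousOn (h2 k)⟩
  have := (L.continuous.tendsto _).comp (h1 k x hx y h)
  refine this.congr fun t => ?_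
  simp

theorem IsBastianiSmoothOn.pi [TopologicalSpace E] {ι : Type*} {U : Set E} {f : ι → E → F}
    (hf : ∀ i, IsBastianiSmoothOn K U (f i)) : IsBastianiSmoothOn K U fun x i => f i x := by
  choose d h0 h1 h2 using hf
  exact ⟨fun k x y i => d i k x y, fun x hx => funext fun i => h0 i x hx,
    fun k x hx y h => tendsto_pi_nhds.2 fun i => h1 i k x hx y h,
    fun k => continuousOn_pi.2 fun i => h2 i k⟩

theorem HasDirectionalDeriv.add [ContinuousAdd F] {f g : E → F} {x h : E} {v w : F}
    (hf : HasDirectionalDeriv K f x h v) (hg : HasDirectionalDeriv K g x h w) :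
    HasDirectionalDeriv K (fun x => f x + g x) x h (v + w) := by
  refine (Tendsto.add hf hg).congr fun t => ?_
  rw [← smul_add, add_sub_add_comm]

theorem hasDirectionalDeriv_const (c : F) (x h : E) :
    HasDirectionalDeriv K (fun _ => c) x h 0 := by
  simpa [HasDirectionalDeriv] using tendsto_const_nhds

theorem hasDirectionalDeriv_linear (ι : E →ₗ[K] F) (x h : E) :
    HasDirectionalDeriv K (fun x => ι x) x h (ι h) := by
  refine tendsto_const_nhds.congr' ?_
  filter_upwards [self_mem_nhdsWithin] with t (ht : t ≠ 0)
  simp [smul_smul, inv_mul_cancel₀ ht]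

/-- The Leibniz rule. -/
theorem HasDirectionalDeriv.bilin [TopologicalSpace E] [ContinuousAdd E] [ContinuousSMul K E] [ContinuousAdd F]
    {m : F →ₗ[K] F →ₗ[K] F} (hm : Continuous fun p : F × F => m p.1 p.2) {f g : E → F} {x h : E}
    {v w : F} (hf : HasDirectionalDeriv K f x h v) (hg : HasDirectionalDeriv K g x h w)
    (hgc : Continuous g) :
    HasDirectionalDeriv K (fun x => m (f x) (g x)) x h (m v (g x) + m (f x) w) := by
  -- The difference quotient of m(f, g) splits as m(quotient of f, g(x + th)) + m(f(x), quotient of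
  -- g).
  have hline : Tendsto (fun t : K => g (x + t • h)) (𝓝[≠] 0) (𝓝 (g x)) := by
    have : Continuous fun t : K => g (x + t • h) := by fun_prop
    have := this.tendsto 0
    rw [zero_smul, add_zero] at this
    exact this.mono_left nhdsWithin_le_nhds
  have h1 := (hm.tendsto (v, g x)).comp (hf.prodMk_nhds hline)
  have h2 := (hm.tendsto (f x, w)).comp (tendsto_const_nhds.prodMk_nhds hg)
  refine (h1.add h2).congr fun t => ?_
  simp only [Function.comp_apply, map_smul, LinearMap.smul_apply, map_sub, LinearMap.sub_apply]
  rw [← smul_add]; congr 1; abel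

end

/-- Polynomial functions of `(x, y₁, …, y_n)` built from a linear map `ι` and a bilinear product
`m`. -/
inductive IsPolynomialMap (m : F →ₗ[K] F →ₗ[K] F) (ι : E →ₗ[K] F) {n : ℕ} :
    (E × (Fin n → E) → F) → Prop
  | const (c : F) : IsPolynomialMap m ι fun _ => c
  | base : IsPolynomialMap m ι fun q => ι q.1
  | direction (i : Fin n) : IsPolynomialMap m ι fun q => ι (q.2 i)
  | add {f g} (hf : IsPolynomialMap m ι f) (hg : IsPolynomialMap m ι g) :
      IsPolynomialMap m ι fun q => f q + g q
  | bilin {f g} (hf : IsPolynomialMap m ι f) (hg : IsPolynomialMap m ι g) :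
      IsPolynomialMap m ι fun q => m (f q) (g q)

namespace IsPolynomialMap

variable {m : F →ₗ[K] F →ₗ[K] F} {ι : E →ₗ[K] F} {n : ℕ}

theorem comp_init {f : E × (Fin n → E) → F} (hf : IsPolynomialMap m ι f) :
    IsPolynomialMap m ι fun q : E × (Fin (n + 1) → E) => f (q.1, Fin.init q.2) := by
  induction hf with
  | const c => exact .const c
  | base => exact .base
  | direction i => exact .direction i.castSucc
  | add _ _ hf hg => exact .add hf hg
  | bilin _ _ hf hg => exact .bilin hf hg

variable [TopologicalSpace E] [TopologicalSpace F]

theorem continuous [ContinuousAdd F] (hm : Continuous fun p : F × F => m p.1 p.2)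
    (hι : Continuous ι) {f : E × (Fin n → E) → F} (hf : IsPolynomialMap m ι f) :
    Continuous f := by
  induction hf with
  | const c => exact continuous_const
  | base => fun_prop
  | direction i => fun_prop
  | add _ _ hf hg => exact hf.add hg
  | bilin _ _ hf hg => exact hm.comp (hf.prodMk hg)

/-- Polynomials differentiate to polynomials in one more direction variable, by the Leibniz rule;
iterating yields all derivatives, continuous because polynomial. -/
theorem exists_hasDirectionalDeriv [ContinuousAdd E] [ContinuousSMul K E] [ContinuousAdd F]
    (hm : Continuous fun p : F × F => m p.1 p.2) (hι : Continuous ι)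
    {f : E × (Fin n → E) → F} (hf : IsPolynomialMap m ι f) :
    ∃ f' : E × (Fin (n + 1) → E) → F, IsPolynomialMap m ι f' ∧ ∀ x y h,
      HasDirectionalDeriv K (fun x' => f (x', y)) x h (f' (x, Fin.snoc y h)) := by
  induction hf with
  | const c => exact ⟨_, .const 0, fun x y h => hasDirectionalDeriv_const c x h⟩
  | base =>
    refine ⟨_, .direction (Fin.last n), fun x y h => ?_⟩
    simpa using hasDirectionalDeriv_linear ι x h
  | direction i => exact ⟨_, .const 0, fun x y h => hasDirectionalDeriv_const (ι (y i)) x h⟩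
  | add _ _ hf hg =>
    obtain ⟨f', hf', hfd⟩ := hf
    obtain ⟨g', hg', hgd⟩ := hg
    exact ⟨_, .add hf' hg', fun x y h => (hfd x y h).add (hgd x y h)⟩
  | @bilin f g hfp hgp hf hg =>
    obtain ⟨f', hf', hfd⟩ := hf
    obtain ⟨g', hg', hgd⟩ := hg
    refine ⟨_, .add (.bilin hf' hgp.comp_init) (.bilin hfp.comp_init hg'), fun x y h => ?_⟩
    have := (hfd x y h).bilin hm (hgd x y h)
      ((hgp.continuous hm hι).comp (Continuous.prodMk_left y))
    simpa using this

theorem isBastianiSmoothOn [ContinuousAdd E] [ContinuousSMul K E] [ContinuousAdd F]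
    (hm : Continuous fun p : F × F => m p.1 p.2) (hι : Continuous ι)
    {f : E × (Fin 0 → E) → F} (hf : IsPolynomialMap m ι f) (U : Set E) :
    IsBastianiSmoothOn K U fun x => f (x, ![]) := by
  choose D hD hDd using fun (n : ℕ) (f : {f : E × (Fin n → E) → F // IsPolynomialMap m ι f}) =>
    f.2.exists_hasDirectionalDeriv hm hι
  let d (k : ℕ) : {f : E × (Fin k → E) → F // IsPolynomialMap m ι f} :=
    Nat.rec ⟨f, hf⟩ (fun k g => ⟨D k g, hD k g⟩) k
  exact ⟨fun k x y => (d k).1 (x, y), fun x _ => rfl, fun k x _ y h => hDd k (d k) x y h,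
    fun k => ((d k).2.continuous hm hι).continuousOn⟩

end IsPolynomialMap

/-- The powers `(⋯((u · ι x) · ι x) ⋯) · ι x` for a bilinear product. -/
def bilinPow (m : F →ₗ[K] F →ₗ[K] F) (u : F) (ι : E →ₗ[K] F) : ℕ → E → F
  | 0, _ => u
  | k + 1, x => m (bilinPow m u ι k x) (ι x)

variable [TopologicalSpace E] [TopologicalSpace F]

theorem isBastianiSmoothOn_bilinPow [ContinuousAdd E] [ContinuousSMul K E] [ContinuousAdd F]
    {m : F →ₗ[K] F →ₗ[K] F} (hm : Continuous fun p : F × F => m p.1 p.2) (u : F)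
    {ι : E →ₗ[K] F} (hι : Continuous ι) (k : ℕ) (U : Set E) :
    IsBastianiSmoothOn K U (bilinPow m u ι k) := by
  have : IsPolynomialMap m ι fun q : E × (Fin 0 → E) => bilinPow m u ι k q.1 := by
    induction k with
    | zero => exact .const u
    | succ k ih => exact .bilin ih .base
  exact this.isBastianiSmoothOn hm hι U

/-- All powers together form a smooth map into a product space, so a series in them is smooth once
it is a continuous linear function of the sequence. -/
theorem isBastianiSmoothOn_clm_bilinPow [AddCommGroup G] [TopologicalSpace G] [Module K G]
    [ContinuousAdd E] [ContinuousSMul K E] [ContinuousAdd F]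
    {m : F →ₗ[K] F →ₗ[K] F} (hm : Continuous fun p : F × F => m p.1 p.2) (u : F)
    {ι : E →ₗ[K] F} (hι : Continuous ι) (L : (ℕ → F) →L[K] G) (U : Set E) :
    IsBastianiSmoothOn K U fun x => L fun k => bilinPow m u ι k x :=
  (IsBastianiSmoothOn.pi fun k => isBastianiSmoothOn_bilinPow hm u hι k U).clm_comp L

end Smooth

/-! ### Complexification of linear and bilinear maps, and analyticity -/

namespace Complexification

variable {𝕜 E : Type*}

/-- The first component of `(u, v) = u + i v`. -/
def re (w : Complexification 𝕜 E) : E := w.1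

/-- The second component of `(u, v) = u + i v`. -/
def im (w : Complexification 𝕜 E) : E := w.2

variable (𝕜) in
/-- The element `u + i v`. -/
def mk (u v : E) : Complexification 𝕜 E := ((u, v) : E × E)

@[ext] theorem ext {w w' : Complexification 𝕜 E} (hre : w.re = w'.re) (him : w.im = w'.im) :
    w = w' := Prod.ext hre him

@[simp] theorem re_mk (u v : E) : (mk 𝕜 u v).re = u := rfl

@[simp] theorem im_mk (u v : E) : (mk 𝕜 u v).im = v := rfl

@[simp] theorem re_incl [AddCommGroup E] (u : E) : (incl 𝕜 u).re = u := rfl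

@[simp] theorem im_incl [AddCommGroup E] (u : E) : (incl 𝕜 u).im = 0 := rfl

@[simp] theorem re_add [AddCommGroup E] (w w' : Complexification 𝕜 E) :
    (w + w').re = w.re + w'.re := rfl

@[simp] theorem im_add [AddCommGroup E] (w w' : Complexification 𝕜 E) :
    (w + w').im = w.im + w'.im := rfl

@[fun_prop] theorem continuous_re [TopologicalSpace E] : Continuous (re : Complexification 𝕜 E → E) :=
  continuous_fst

@[fun_prop] theorem continuous_im [TopologicalSpace E] : Continuous (im : Complexification 𝕜 E → E) :=
  continuous_snd

theorem continuous_mk {X : Type*} [TopologicalSpace X] [TopologicalSpace E] {f g : X → E}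
    (hf : Continuous f) (hg : Continuous g) : Continuous fun x => mk 𝕜 (f x) (g x) := hf.prodMk hg

variable {F : Type*} [RCLike 𝕜] [AddCommGroup E] [Module 𝕜 E] [AddCommGroup F] [Module 𝕜 F]

@[simp] theorem re_smul (z : ℂ) (w : Complexification 𝕜 E) :
    (z • w).re = (z.re : 𝕜) • w.re - (z.im : 𝕜) • w.im := rfl

@[simp] theorem im_smul (z : ℂ) (w : Complexification 𝕜 E) :
    (z • w).im = (z.re : 𝕜) • w.im + (z.im : 𝕜) • w.re := rfl

instance [TopologicalSpace E] [ContinuousAdd E] : ContinuousAdd (Complexification 𝕜 E) :=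
  inferInstanceAs (ContinuousAdd (E × E))

instance [TopologicalSpace E] [IsTopologicalAddGroup E] [ContinuousSMul 𝕜 E] :
    ContinuousSMul ℂ (Complexification 𝕜 E) where
  continuous_smul := by
    have hre : Continuous fun p : ℂ × Complexification 𝕜 E => ((p.1.re : ℝ) : 𝕜) :=
      RCLike.continuous_ofReal.comp (Complex.continuous_re.comp continuous_fst)
    have him : Continuous fun p : ℂ × Complexification 𝕜 E => ((p.1.im : ℝ) : 𝕜) :=
      RCLike.continuous_ofReal.comp (Complex.continuous_im.comp continuous_fst)
    have h1 : Continuous fun p : ℂ × Complexification 𝕜 E => p.2.re := by fun_prop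
    have h2 : Continuous fun p : ℂ × Complexification 𝕜 E => p.2.im := by fun_prop
    exact continuous_mk ((hre.smul h1).sub (him.smul h2)) ((hre.smul h2).add (him.smul h1))

/-- The complexification of a linear map. -/
def mapₗ (L : E →ₗ[𝕜] F) : Complexification 𝕜 E →ₗ[ℂ] Complexification 𝕜 F where
  toFun w := mk 𝕜 (L w.re) (L w.im)
  map_add' w w' := by ext <;> simp
  map_smul' z w := by ext <;> simp

@[simp] theorem mapₗ_apply (L : E →ₗ[𝕜] F) (w : Complexification 𝕜 E) :
    mapₗ L w = mk 𝕜 (L w.re) (L w.im) := rfl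

/-- The complexification of a continuous linear map on a space of sequences. -/
def mapSeq {G : Type*} [TopologicalSpace F] [AddCommGroup G] [TopologicalSpace G] [Module 𝕜 G]
    (L : (ℕ → F) →L[𝕜] G) :
    (ℕ → Complexification 𝕜 F) →L[ℂ] Complexification 𝕜 G where
  toFun w := mk 𝕜 (L fun k => (w k).re) (L fun k => (w k).im)
  map_add' w w' := by
    ext
    · exact map_add L _ _
    · exact map_add L _ _
  map_smul' z w := by
    ext
    · simp only [re_smul, re_mk, im_mk, RingHom.id_apply, ← map_smul, ← map_sub]; rfl
    · simp only [im_smul, re_mk, im_mk, RingHom.id_apply, ← map_smul, ← map_add]; rfl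
  cont := continuous_mk (L.continuous.comp (by fun_prop)) (L.continuous.comp (by fun_prop))

/-- The complexification of a bilinear map. -/
def bilin (m : F →ₗ[𝕜] F →ₗ[𝕜] F) :
    Complexification 𝕜 F →ₗ[ℂ] Complexification 𝕜 F →ₗ[ℂ] Complexification 𝕜 F :=
  LinearMap.mk₂ ℂ
    (fun v w => mk 𝕜 (m v.re w.re - m v.im w.im) (m v.re w.im + m v.im w.re))
    (fun v v' w => by ext <;> simp <;> abel)
    (fun z v w => by ext <;> simp <;> module)
    (fun v w w' => by ext <;> simp <;> abel)
    (fun z v w => by ext <;> simp <;> module)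

@[simp] theorem bilin_apply (m : F →ₗ[𝕜] F →ₗ[𝕜] F) (v w : Complexification 𝕜 F) :
    bilin m v w = mk 𝕜 (m v.re w.re - m v.im w.im) (m v.re w.im + m v.im w.re) := rfl

theorem continuous_bilin [TopologicalSpace F] [IsTopologicalAddGroup F] {m : F →ₗ[𝕜] F →ₗ[𝕜] F}
    (hm : Continuous fun p : F × F => m p.1 p.2) :
    Continuous fun p : Complexification 𝕜 F × Complexification 𝕜 F => bilin m p.1 p.2 := by
  have h {f g : Complexification 𝕜 F × Complexification 𝕜 F → F} (hf : Continuous f)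
      (hg : Continuous g) : Continuous fun p => m (f p) (g p) := hm.comp (hf.prodMk hg)
  exact continuous_mk ((h (by fun_prop) (by fun_prop)).sub (h (by fun_prop) (by fun_prop)))
    ((h (by fun_prop) (by fun_prop)).add (h (by fun_prop) (by fun_prop)))

theorem bilinPow_incl (m : F →ₗ[𝕜] F →ₗ[𝕜] F) (u : F) (ι : E →ₗ[𝕜] F) (k : ℕ) (x : E) :
    bilinPow (bilin m) (incl 𝕜 u) (mapₗ ι) k (incl 𝕜 x) = incl 𝕜 (bilinPow m u ι k x) := by
  induction k with
  | zero => rfl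
  | succ k ih =>
    rw [bilinPow, ih]
    ext <;> simp [bilinPow]

end Complexification

/-- In the real case the complexified data define an extension to the whole complexification, smooth
by the same lemma as in the complex case. -/
theorem isAnalyticMapOn_clm_bilinPow {𝕜 E F G : Type*} [RCLike 𝕜]
    [AddCommGroup E] [TopologicalSpace E] [Module 𝕜 E] [IsTopologicalAddGroup E]
    [ContinuousSMul 𝕜 E] [AddCommGroup F] [TopologicalSpace F] [Module 𝕜 F]
    [IsTopologicalAddGroup F] [AddCommGroup G] [TopologicalSpace G] [Module 𝕜 G]
    {m : F →ₗ[𝕜] F →ₗ[𝕜] F} (hm : Continuous fun p : F × F => m p.1 p.2) (u : F)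
    {ι : E →ₗ[𝕜] F} (hι : Continuous ι) (L : (ℕ → F) →L[𝕜] G) (U : Set E) :
    IsAnalyticMapOn 𝕜 U fun x => L fun k => bilinPow m u ι k x := by
  refine ⟨fun _ => ⟨Set.univ, fun w => Complexification.mapSeq L fun k =>
    bilinPow (Complexification.bilin m) (Complexification.incl 𝕜 u) (Complexification.mapₗ ι) k w,
    isOpen_univ, fun _ _ => trivial, fun x _ => ?_, ?_⟩,
    fun _ => isBastianiSmoothOn_clm_bilinPow hm u hι L U⟩
  · simp only [Complexification.bilinPow_incl]
    exact Complexification.ext rfl (map_zero L)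
  · have hι' : Continuous (Complexification.mapₗ ι) :=
      Complexification.continuous_mk (hι.comp Complexification.continuous_re)
        (hι.comp Complexification.continuous_im)
    exact isBastianiSmoothOn_clm_bilinPow (Complexification.continuous_bilin hm) _ hι' _ _

end

noncomputable section

/-! ### The topology of pointwise convergence -/

section Pointwise

variable {𝕜 M B : Type*} [Semiring 𝕜] [AddCommGroup M] [AddCommGroup B] [Module 𝕜 M] [Module 𝕜 B]
  [TopologicalSpace B]

variable (𝕜 M B) in
theorem isInducing_ltoFun : IsInducing fun (φ : M →ₗ[𝕜] B) (x : M) => φ x := ⟨rfl⟩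

theorem continuous_pointwise_iff {X : Type*} [TopologicalSpace X] {f : X → M →ₗ[𝕜] B} :
    Continuous f ↔ ∀ x, Continuous fun t => f t x :=
  (isInducing_ltoFun 𝕜 M B).continuous_iff.trans continuous_pi_iff

@[fun_prop]
theorem continuous_eval_pointwise (x : M) : Continuous fun φ : M →ₗ[𝕜] B => φ x :=
  continuous_pointwise_iff.1 continuous_id x

theorem hasSum_pointwise_iff {ι : Type*} {f : ι → M →ₗ[𝕜] B} {φ : M →ₗ[𝕜] B} :
    HasSum f φ ↔ ∀ x, HasSum (fun i => f i x) (φ x) := by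
  let g : (M →ₗ[𝕜] B) →+ (M → B) :=
    { toFun := fun φ x => φ x, map_zero' := rfl, map_add' := fun _ _ => rfl }
  have hg : IsInducing g := isInducing_ltoFun 𝕜 M B
  rw [← hg.hasSum_iff, Pi.hasSum]
  rfl

instance [T2Space B] : T2Space (M →ₗ[𝕜] B) :=
  .of_injective_continuous (f := fun (φ : M →ₗ[𝕜] B) (x : M) => φ x) DFunLike.coe_injective
    (isInducing_ltoFun 𝕜 M B).continuous

instance [IsTopologicalAddGroup B] : IsTopologicalAddGroup (M →ₗ[𝕜] B) where
  continuous_add := continuous_pointwise_iff.2 fun x =>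
    ((continuous_eval_pointwise x).comp continuous_fst).add
      ((continuous_eval_pointwise x).comp continuous_snd)
  continuous_neg := continuous_pointwise_iff.2 fun x => (continuous_eval_pointwise x).neg

end Pointwise

instance {𝕜 M B : Type*} [CommSemiring 𝕜] [AddCommGroup M] [AddCommGroup B] [Module 𝕜 M]
    [Module 𝕜 B] [TopologicalSpace B] [TopologicalSpace 𝕜] [ContinuousSMul 𝕜 B] :
    ContinuousSMul 𝕜 (M →ₗ[𝕜] B) where
  continuous_smul := continuous_pointwise_iff.2 fun x =>
    continuous_fst.smul ((continuous_eval_pointwise x).comp continuous_snd)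

/-! ### Continuity of convolution and of the summation map -/

section Convolution

variable {𝕜 C B : Type*} [Field 𝕜] [AddCommGroup C] [Module 𝕜 C] [Ring B] [Algebra 𝕜 B]

/-- The convolution product as a bilinear map. -/
def convBilin (𝕜 C B : Type*) [Field 𝕜] [AddCommGroup C] [Module 𝕜 C] [Coalgebra 𝕜 C] [Ring B]
    [Algebra 𝕜 B] : (C →ₗ[𝕜] B) →ₗ[𝕜] (C →ₗ[𝕜] B) →ₗ[𝕜] (C →ₗ[𝕜] B) :=
  LinearMap.mk₂ 𝕜 (fun f g => (WithConv.toConv f * WithConv.toConv g).ofConv)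
    (fun f f' g => by rw [WithConv.toConv_add, add_mul, WithConv.ofConv_add])
    (fun c f g => by rw [WithConv.toConv_smul, smul_mul_assoc, WithConv.ofConv_smul])
    (fun f g g' => by rw [WithConv.toConv_add, mul_add, WithConv.ofConv_add])
    (fun c f g => by rw [WithConv.toConv_smul, mul_smul_comm, WithConv.ofConv_smul])

theorem hasSum_glueExp [Coalgebra 𝕜 C] [TopologicalSpace B] [ContinuousAdd B] {𝒞 : ℕ → Submodule 𝕜 C}
    (h𝒞 : IsGradedCoalgebra 𝒞) (h : DirectSum.IsInternal 𝒞) {w : ℕ → C →ₗ[𝕜] B}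
    (hw : ∀ k, ∀ n < k, ∀ a ∈ 𝒞 n, w k a = 0) :
    HasSum (fun k => (k.factorial : 𝕜)⁻¹ • w k) (glueExp h w) := by
  refine hasSum_pointwise_iff.2 fun x => ?_
  induction x using h𝒞.induction with
  | mem n a ha =>
    rw [glueExp_apply h _ ha]
    refine hasSum_sum_of_ne_finset_zero fun k hk => ?_
    rw [LinearMap.smul_apply, hw k n (by simpa [Nat.lt_succ_iff] using hk) a ha, smul_zero]
  | add a b ha hb => simpa only [map_add] using ha.add hb

variable [TopologicalSpace B] [IsTopologicalRing B]

/-- A coproduct is a finite sum of pure tensors, so evaluating f ⋆ g at a point is a finite sum of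
products of evaluations. -/
theorem continuous_convBilin [Coalgebra 𝕜 C] :
    Continuous fun p : (C →ₗ[𝕜] B) × (C →ₗ[𝕜] B) => convBilin 𝕜 C B p.1 p.2 := by
  refine continuous_pointwise_iff.2 fun x => ?_
  change Continuous fun p : (C →ₗ[𝕜] B) × (C →ₗ[𝕜] B) =>
    LinearMap.mul' 𝕜 B (TensorProduct.map p.1 p.2 (Coalgebra.comul x))
  induction (Coalgebra.comul (R := 𝕜) x) with
  | zero => simpa using continuous_const
  | add s t hs ht => simp only [map_add]; exact hs.add ht
  | tmul a b =>
    exact ((continuous_eval_pointwise a).comp continuous_fst).mul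
      ((continuous_eval_pointwise b).comp continuous_snd)

variable [TopologicalSpace 𝕜] [ContinuousSMul 𝕜 B]

/-- `glueExp` as a continuous linear map. -/
def glueExpL [Coalgebra 𝕜 C] {𝒞 : ℕ → Submodule 𝕜 C} (h𝒞 : IsGradedCoalgebra 𝒞)
    (h : DirectSum.IsInternal 𝒞) : (ℕ → C →ₗ[𝕜] B) →L[𝕜] (C →ₗ[𝕜] B) where
  toFun := glueExp h
  map_add' w w' := by
    ext x
    induction x using h𝒞.induction with
    | mem n a ha =>
      simp [glueExp_apply h _ ha, Finset.sum_add_distrib]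
    | add a b ha hb => rw [map_add, map_add, ha, hb]
  map_smul' c w := by
    ext x
    induction x using h𝒞.induction with
    | mem n a ha =>
      simp [glueExp_apply h _ ha, Finset.smul_sum, smul_comm c]
    | add a b ha hb => rw [map_add, map_add, ha, hb]
  -- At a point of degree n only the coordinates k ≤ n of the sequence enter.
  cont := continuous_pointwise_iff.2 fun x => by
    induction x using h𝒞.induction with
    | mem n a ha =>
      simp only [glueExp_apply h _ ha]
      exact continuous_finsetSum _ fun k _ =>
        ((continuous_eval_pointwise a).comp (continuous_apply k)).const_smul _
    | add a b ha hb => simp only [map_add]; exact ha.add hb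

end Convolution

/-! ### The exponential of a graded connected Hopf algebra -/

section Exponential

variable {𝕜 H B : Type*} [RCLike 𝕜] [Ring H] [HopfAlgebra 𝕜 H] [Ring B] [Algebra 𝕜 B]
  {𝒜 : ℕ → Submodule 𝕜 H}

namespace IsGradedConnected

theorem convPow_apply_eq_zero (h𝒜 : IsGradedConnected 𝒜) (ψ : positivePart 𝒜 →ₗ[𝕜] B)
    (k n : ℕ) (hn : n < k) (a : H) (ha : a ∈ 𝒜 n) : convPow (extendByZero h𝒜 ψ) k a = 0 :=
  h𝒜.isGradedCoalgebra.isSeparatedFiltration.pow_mem (h𝒜.extendByZero_mem ψ) k n hn a ha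

/-- `extendByZero` as a linear map. -/
def extendByZeroₗ (h𝒜 : IsGradedConnected 𝒜) : (positivePart 𝒜 →ₗ[𝕜] B) →ₗ[𝕜] (H →ₗ[𝕜] B) where
  toFun := extendByZero h𝒜
  map_add' _ _ := rfl
  map_smul' _ _ := rfl

theorem bilinPow_convBilin (h𝒜 : IsGradedConnected 𝒜) (k : ℕ) (ψ : positivePart 𝒜 →ₗ[𝕜] B) :
    bilinPow (convBilin 𝕜 H B) (1 : WithConv (H →ₗ[𝕜] B)).ofConv h𝒜.extendByZeroₗ k ψ =
      convPow (extendByZero h𝒜 ψ) k := by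
  induction k with
  | zero => rw [bilinPow, convPow, pow_zero]
  | succ k ih => rw [bilinPow, ih, convPow, convPow, pow_succ]; rfl

variable [TopologicalSpace B] [IsTopologicalRing B]

theorem hasSum_glueExp_convPow (h𝒜 : IsGradedConnected 𝒜) (ψ : positivePart 𝒜 →ₗ[𝕜] B) :
    HasSum (fun k : ℕ => (k.factorial : 𝕜)⁻¹ • convPow (extendByZero h𝒜 ψ) k)
      (glueExp h𝒜.isInternal fun k => convPow (extendByZero h𝒜 ψ) k) :=
  hasSum_glueExp h𝒜.isGradedCoalgebra h𝒜.isInternal (h𝒜.convPow_apply_eq_zero ψ)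

theorem convExp_eq [T2Space B] (h𝒜 : IsGradedConnected 𝒜) (ψ : positivePart 𝒜 →ₗ[𝕜] B) :
    convExp h𝒜 ψ = glueExp h𝒜.isInternal fun k => convPow (extendByZero h𝒜 ψ) k :=
  (h𝒜.hasSum_glueExp_convPow ψ).tsum_eq

theorem isFilteredExp_convExp [T2Space B] (h𝒜 : IsGradedConnected 𝒜)
    (ψ : positivePart 𝒜 →ₗ[𝕜] B) :
    IsFilteredExp (vanishingBelow 𝒜 B) (WithConv.toConv (extendByZero h𝒜 ψ))
      (WithConv.toConv (convExp h𝒜 ψ)) := by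
  rw [convExp_eq]
  exact isFilteredExp_glueExp h𝒜.isGradedCoalgebra h𝒜.isInternal (h𝒜.extendByZero_mem ψ)

theorem isAnalyticMapOn_convExp [ContinuousSMul 𝕜 B] [T2Space B] (h𝒜 : IsGradedConnected 𝒜) :
    IsAnalyticMapOn 𝕜 Set.univ (convExp h𝒜 : (positivePart 𝒜 →ₗ[𝕜] B) → (H →ₗ[𝕜] B)) := by
  have hι : Continuous (h𝒜.extendByZeroₗ : (positivePart 𝒜 →ₗ[𝕜] B) →ₗ[𝕜] (H →ₗ[𝕜] B)) :=
    continuous_pointwise_iff.2 fun x => continuous_eval_pointwise _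
  have := isAnalyticMapOn_clm_bilinPow (continuous_convBilin (𝕜 := 𝕜) (C := H) (B := B))
    (1 : WithConv (H →ₗ[𝕜] B)).ofConv hι (glueExpL h𝒜.isGradedCoalgebra h𝒜.isInternal) Set.univ
  convert this using 2 with ψ
  simp only [bilinPow_convBilin]
  exact h𝒜.convExp_eq ψ

theorem bijOn_convExp [T2Space B] (h𝒜 : IsGradedConnected 𝒜) (hB : ∀ a b : B, a * b = b * a) :
    Set.BijOn (convExp h𝒜) (extendByZero h𝒜 ⁻¹' infinitesimalCharacters 𝕜 H B)
      (characters 𝕜 H B) := by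
  have hJ := h𝒜.isGradedCoalgebra.isSeparatedFiltration (B := B)
  have hmem (ψ : positivePart 𝒜 →ₗ[𝕜] B) :=
    h𝒜.exp_mem_characters_iff hB (h𝒜.extendByZero_mem ψ) (h𝒜.isFilteredExp_convExp ψ)
  refine ⟨fun ψ hψ => (hmem ψ).2 hψ, fun ψ _ ψ' _ h => ?_, fun χ hχ => ?_⟩
  · have h' := h𝒜.isFilteredExp_convExp ψ'
    rw [← h] at h'
    exact h𝒜.extendByZero_injective (WithConv.toConv_injective (hJ.exp_injective
      (h𝒜.extendByZero_mem ψ) (h𝒜.extendByZero_mem ψ') (h𝒜.isFilteredExp_convExp ψ) h'))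
  -- A unital map agrees with the counit on H_0, so χ lies in 1 + J 1 and has a preimage in J 1;
  -- that this is an infinitesimal character is the forward direction of `hmem`.
  · have h1 : WithConv.toConv χ - 1 ∈ vanishingBelow 𝒜 B 1 := h𝒜.mem_vanishingBelow_one <| by
      change χ 1 - algebraMap 𝕜 B (Coalgebra.counit (1 : H)) = 0
      rw [hχ.2, Bialgebra.counit_one, map_one, sub_self]
    obtain ⟨φ, hφ, hφχ⟩ := hJ.exp_surjective (exists_sub_mem_vanishingBelow h𝒜.isInternal)
      (fun φ hφ => isFilteredExp_glueExp h𝒜.isGradedCoalgebra h𝒜.isInternal hφ) h1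
    have h2 : convExp h𝒜 (φ.ofConv ∘ₗ (positivePart 𝒜).subtype) = χ := by
      rw [h𝒜.convExp_eq, h𝒜.extendByZero_restrict hφ]
      exact congrArg WithConv.ofConv hφχ
    exact ⟨_, (hmem _).1 (by rw [h2]; exact hχ), h2⟩

end IsGradedConnected

end Exponential

end

theorem mainTheorem6 {𝕜 H B : Type*} [RCLike 𝕜]
    [Ring H] [HopfAlgebra 𝕜 H] (𝒜 : ℕ → Submodule 𝕜 H) (h𝒜 : IsGradedConnected 𝒜)
    [Ring B] [Algebra 𝕜 B] [TopologicalSpace B] [IsTopologicalRing B] [ContinuousSMul 𝕜 B]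
    [PolynormableSpace 𝕜 B] [T2Space B] :
    -- the exponential series is well defined
    (∀ ψ : positivePart 𝒜 →ₗ[𝕜] B,
      (∀ n : ℕ, {k : ℕ | ∃ x ∈ 𝒜 n, convPow (extendByZero h𝒜 ψ) k x ≠ 0}.Finite) ∧
      HasSum (fun k : ℕ => (k.factorial : 𝕜)⁻¹ • convPow (extendByZero h𝒜 ψ) k) (convExp h𝒜 ψ)) ∧
    -- the exponential map is analytic
    IsAnalyticMapOn 𝕜 Set.univ (convExp h𝒜 : (positivePart 𝒜 →ₗ[𝕜] B) → (H →ₗ[𝕜] B)) ∧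
    -- it restricts to a bijection from infinitesimal characters to characters
    ((∀ a b : B, a * b = b * a) →
      infinitesimalCharacters 𝕜 H B ⊆ Set.range (extendByZero h𝒜) ∧
      Set.BijOn (convExp h𝒜) (extendByZero h𝒜 ⁻¹' infinitesimalCharacters 𝕜 H B)
        (characters 𝕜 H B)) := by
  refine ⟨fun ψ => ⟨fun n => (Set.finite_Iic n).subset ?_, ?_⟩, h𝒜.isAnalyticMapOn_convExp,
    fun hB => ⟨fun φ hφ => ?_, h𝒜.bijOn_convExp hB⟩⟩
  · rintro k ⟨x, hx, hne⟩
    exact not_lt.1 fun hk => hne (h𝒜.convPow_apply_eq_zero ψ k n hk x hx)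
  · rw [h𝒜.convExp_eq]
    exact h𝒜.hasSum_glueExp_convPow ψ
  · exact ⟨_, h𝒜.extendByZero_restrict
      (h𝒜.mem_vanishingBelow_one (infinitesimalCharacters_apply_one hφ))⟩
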